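/- Let $d\ge 1$, let $v_{\min},v_{\max},C_\beta,c,C,C_{f},C_{\mathcal S},\varepsilon_0,L,l>0$ be constants. For every $n$ let $m_1,\dots,m_n\ge 1$ be integers (which may depend on $n$) with harmonic mean $m=\big(\frac1n\sum_{i=1}^n\frac1{m_i}\big)^{-1}$ and $cm\le m_i\le Cm$ for all $i$, and let $\{x_{i,j}\}_{1\le i\le n,\,1\le j\le m_i}$ be random points of $[0,1]^d$ (on a probability space that may depend on $n$) such that * every $x_{i,j}$ has the same density $v$ on $[0,1]^d$, with $v_{\min}\le v\le v_{\max}$ there; * for each fixed $i$ the points $x_{i,1},\dots,x_{i,m_i}$ are independent; * the $\sigma$-algebras $\sigma_x(i)=\sigma(x_{i,j},\,j\le m_i)$ are $\beta$-mixing with $\beta_x(k)\le e^{-C_\beta k}$ for all integers $k\ge0$, where $\beta_x(k)=\sup_t\beta\big(\sigma(\sigma_x(s),s\le t),\sigma(\sigma_x(s),s\ge t+k)\big)$ and $\beta(\mathcal A,\mathcal B)=\mathbb E\sup_{B\in\mathcal B}|\mathbb P(B)-\mathbb P(B\mid\mathcal A)|$ (essential supremum). Let $f^*:[0,1]^d\to\mathbb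 R$ be piecewise Lipschitz with these constants: $|f^*|\le C_f$, and there is a Lebesgue null set $\mathcal S\subset(0,1)^d$ such that, with $B_\varepsilon(A)=\{a:\exists a'\in A,\ \|a-a'\|_2\le\varepsilon\}$ and $\Omega_\varepsilon=[0,1]^d\setminus B_\varepsilon(\partial[0,1]^d)$, for all $0<\varepsilon<\varepsilon_0$: $\mathrm{Vol}\big(B_\varepsilon(\mathcal S)\cup([0,1]^d\setminus\Omega_\varepsilon)\big)\le C_{\mathcal S}\,\varepsilon$, and $|f^*(z)-f^*(z')|\le L\|z-z'\|_2$ whenever $z,z'$ lie in the same connected component of $\Omega_\varepsilon\setminus B_\varepsilon(\mathcal S)$. Here $v$, $f^*$ and $\mathcal S$ may depend on $n$, but the constants may not. Let $K=\lceil\log^{2+l}(nm)\rceil$ and let $G_K$, with edge set $E_K$, be the $K$-nearest-neighbour graph of the points $x_{i,j}$: two distinct indices are joined if and only if the point of one is among the $K$ nearest neighbours of the point of the other (all ties being kept: $x_q$ is among the $K$ nearest neighbours of $x_p$ if fewer than $K$ of the points other than $x_p$ are strictly closer to $x_p$ than $x_q$). Put $\theta^*_{i,j}=f^*(x_{i,j})$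 and $\|\nabla_{G_K}\theta^*\|_1=\sum_{\{p,q\}\in E_K}|\theta^*_p-\theta^*_q|$. Then, as $n\to\infty$, $$\|\nabla_{G_K}\theta^*\|_1=O_{\mathbb P}\Big((nm)^{1-1/d}\,\log^{2+l+\frac{2+l}{d}}(nm)\Big),$$ where $X_n=O_{\mathbb P}(a_n)$ means $\lim_{M\to\infty}\limsup_{n}\mathbb P(|X_n|\ge M a_n)=0$. -/

import Mathlib

open MeasureTheory ProbabilityTheory Filter Topology

noncomputable section

/-- Euclidean space `ℝ^d` with the `ℓ₂` norm. -/
abbrev Euc (d : ℕ) : Type := EuclideanSpace ℝ (Fin d)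

/-! ### Piecewise Lipschitz functions -/

/-- The closed unit cube `[0,1]^d`. -/
def unitCube (d : ℕ) : Set (Euc d) := {z | ∀ k, z k ∈ Set.Icc (0 : ℝ) 1}

/-- The open unit cube `(0,1)^d`. -/
def openCube (d : ℕ) : Set (Euc d) := {z | ∀ k, z k ∈ Set.Ioo (0 : ℝ) 1}

/-- `B_ε(A)`: the points at distance at most `ε` from some point of `A`. -/
def nbhd {d : ℕ} (ε : ℝ) (A : Set (Euc d)) : Set (Euc d) := {a | ∃ a' ∈ A, dist a a' ≤ ε}

/-- `Ω_ε = [0,1]^d \ B_ε(∂[0,1]^d)`. -/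
def innerCube (d : ℕ) (ε : ℝ) : Set (Euc d) := unitCube d \ nbhd ε (frontier (unitCube d))

/-- `f` is a piecewise Lipschitz function on `[0,1]^d`, bounded by `C_f`, with exceptional set `S`
and constants `C_S`, `ε₀`, `L`.  A function is piecewise Lipschitz if this holds for some `S` and
some positive constants. -/
structure IsPiecewiseLipschitzOff {d : ℕ} (f : Euc d → ℝ) (S : Set (Euc d))
    (C_f C_S ε₀ L : ℝ) : Prop where
  bounded : ∀ z ∈ unitCube d, |f z| ≤ C_f
  subset : S ⊆ openCube d
  null : volume S = 0
  volume_le : ∀ ε : ℝ, 0 < ε → ε < ε₀ →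
    volume (nbhd ε S ∪ (unitCube d \ innerCube d ε)) ≤ ENNReal.ofReal (C_S * ε)
  lipschitz : ∀ ε : ℝ, 0 < ε → ε < ε₀ →
    ∀ z ∈ innerCube d ε \ nbhd ε S,
      ∀ z' ∈ connectedComponentIn (innerCube d ε \ nbhd ε S) z,
        |f z - f z'| ≤ L * dist z z'

/-! ### β-mixing -/

/-- The coefficient `β(𝒜, ℬ) = E sup_{C ∈ ℬ} |P(C) - P(C | 𝒜)|`.  As conditional probabilities
are only defined up to null sets, the supremum over the (uncountable) family is the essential one;
its expectation is the supremum, over finite subfamilies `F`, of the expected maximum over `F`,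
which is what is written here. -/
def betaMixCoeff {Ω : Type*} [MeasurableSpace Ω] (P : Measure Ω)
    (𝒜 ℬ : MeasurableSpace Ω) : ENNReal :=
  ⨆ F : Finset {C : Set Ω // MeasurableSet[ℬ] C},
    ∫⁻ ω, ⨆ C ∈ F,
      ENNReal.ofReal |P.real (C : Set Ω) - (P[(C : Set Ω).indicator (fun _ => (1 : ℝ)) | 𝒜]) ω| ∂P

/-- The coefficient `β(l)` of a finite sequence of σ-algebras `σ 0, …, σ (n-1)`: the supremum
over `t` of `β(σ(σ_s, s ≤ t), σ(σ_s, s ≥ t + l))`. -/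
def betaMixSeq {Ω : Type*} [MeasurableSpace Ω] (P : Measure Ω) {n : ℕ}
    (σ : Fin n → MeasurableSpace Ω) (l : ℕ) : ENNReal :=
  ⨆ t : Fin n, betaMixCoeff P
    (⨆ (s : Fin n) (_ : s ≤ t), σ s)
    (⨆ (s : Fin n) (_ : (t : ℕ) + l ≤ (s : ℕ)), σ s)

/-! ### The random design -/

/-- The harmonic mean of `m_1, …, m_n`. -/
def harmonicMean {n : ℕ} (m : Fin n → ℕ) : ℝ := ((1 / (n : ℝ)) * ∑ i, 1 / (m i : ℝ))⁻¹

/-- The assumptions on the design points `x_{i,j}`, `1 ≤ i ≤ n`, `1 ≤ j ≤ m_i`. -/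
structure DesignAssumption {Ω : Type*} [MeasurableSpace Ω] (P : Measure Ω) {d n : ℕ}
    (m : Fin n → ℕ) (x : (i : Fin n) → Fin (m i) → Ω → Euc d) (v : Euc d → ℝ)
    (vmin vmax Cβ c C : ℝ) : Prop where
  measurable : ∀ i j, Measurable (x i j)
  measurable_density : Measurable v
  density_bounds : ∀ z ∈ unitCube d, vmin ≤ v z ∧ v z ≤ vmax
  /-- every `x_{i,j}` has density `v` on `[0,1]^d` -/
  law : ∀ i j, P.map (x i j) =
    (volume.restrict (unitCube d)).withDensity (fun z => ENNReal.ofReal (v z))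
  /-- the σ-algebras `σ(x_{i,j}, j ∈ [m_i])` are exponentially β-mixing in `i` -/
  mixing : ∀ l : ℕ,
    betaMixSeq P (fun i => ⨆ j, MeasurableSpace.comap (x i j) inferInstance) l
      ≤ ENNReal.ofReal (Real.exp (-Cβ * l))
  /-- for each fixed `i` the points `x_{i,j}` are independent -/
  indep : ∀ i, iIndepFun (x i) P
  pos : ∀ i, 0 < m i
  comparable : ∀ i, c * harmonicMean m ≤ (m i : ℝ) ∧ (m i : ℝ) ≤ C * harmonicMean m

/-! ### The `K`-nearest neighbour graph and its total variation -/

/-- `x q` is among the `K` nearest neighbours of `x p` within the other points: fewer than `K`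
of the points other than `x p` are strictly closer to `x p` than `x q`.  Ties are all kept. -/
def IsKNearest {V : Type*} {d : ℕ} (K : ℕ) (x : V → Euc d) (p q : V) : Prop :=
  {r | r ≠ p ∧ dist (x p) (x r) < dist (x p) (x q)}.ncard < K

/-- The symmetric `K`-nearest neighbour graph of a finite family of points. -/
def knnGraph {V : Type*} {d : ℕ} (K : ℕ) (x : V → Euc d) : SimpleGraph V where
  Adj p q := p ≠ q ∧ (IsKNearest K x p q ∨ IsKNearest K x q p)
  symm := ⟨fun _ _ h => ⟨h.1.symm, h.2.symm⟩⟩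
  loopless := ⟨fun _ h => h.1 rfl⟩

open Classical in
/-- `‖∇_G θ‖₁`: the sum of `|θ_p - θ_q|` over the (unordered) edges `{p, q}` of `G`. -/
def graphTV {V : Type*} [Fintype V] (G : SimpleGraph V) (θ : V → ℝ) : ℝ :=
  ∑ e ∈ G.edgeFinset, Sym2.lift ⟨fun p q => |θ p - θ q|, fun p q => abs_sub_comm (θ p) (θ q)⟩ e

/-! ### Stochastic order -/

/-- `X_n = O_P(a_n)`: `lim_{M → ∞} limsup_n P(|X_n| ≥ M a_n) = 0`. -/
def IsBigOInProb {Ω : ℕ → Type*} [∀ n, MeasurableSpace (Ω n)] (P : (n : ℕ) → Measure (Ω n))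
    (X : (n : ℕ) → Ω n → ℝ) (a : ℕ → ℝ) : Prop :=
  Tendsto (fun M : ℝ => limsup (fun n => P n {ω | M * a n ≤ |X n ω|}) atTop) atTop (𝓝 0)

end

/-!
The rate comes from a grid of cells of volume of order `K / (nm)`. Suppose that every cell holds
more than `K` and at most a constant times `K` design points. Then the `K` nearest neighbours of
a point, ties included, lie within the diameter `δ` of a cell, so edges have length at most `δ`, and degrees
are `O(K)`, because a ball of radius `δ` meets boundedly many cells. An edge with an end point
outside the `2δ`-neighbourhood of the exceptional set and of the boundary of the cube contributes at
most `L δ`, since the segment between its end points avoids the `δ`-neighbourhood; the other edges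
contribute at most `2 C_f` each (`graphTV_knnGraph_le`). The bad neighbourhood has volume `O(δ)`, so
by Markov's inequality it holds `O_P(nm δ)` points, whatever the dependence. Altogether the total
variation is `O_P(K nm δ)` with `δ` of order `(K / (nm))^{1/d}`.

Cell counts concentrate as follows. Let `a` be a large multiple of `log (nm)` and split the indices
`i` into residue classes modulo `a`. Two consecutive members of a class are `a` apart, so within a
class each summand may be replaced by an independent copy at cost `β(a) ≤ exp (-C_β a)`, a
negligible power of `nm` (`integral_comp_add_le_of_betaMixCoeff`, `integral_comp_sum_le_of_mixing`).
This gives Chernoff bounds for each class, and a deviation of the total count forces one in some class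
(`measureReal_count_deviation_le`). The mean count in a class is of order `K / a`, which is at least
of order `log^{1+l} (nm)`, so the failure probability survives the union bound over all cells and
classes (`eventually_exists_scales`). No case distinction between `a ≤ n` and `a > n` is needed: a
class may be a singleton, as points with the same index `i` are independent anyway.
-/

/-! ### Mixing and exponential moments -/

/-- For an `𝒜`-measurable `S` and a bounded `ℬ`-measurable `Y`, replacing `Y` by an independent copy
lowers the expectation of a `[0,1]`-valued function of `S + Y` by at most `β(𝒜, ℬ)`.
Conditionally on `𝒜`, the positive part of the signed measure `P(Y ∈ · | 𝒜) - P(Y ∈ ·)` is carried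
by one of the finitely many sets of values of `Y`, so it is dominated by the maximum in `β`. -/
lemma integral_comp_add_le_of_betaMixCoeff {Ω : Type*} {𝒜 ℬ : MeasurableSpace Ω}
    [m0 : MeasurableSpace Ω] (P : Measure Ω) [IsProbabilityMeasure P]
    (h𝒜 : 𝒜 ≤ m0) (hℬ : ℬ ≤ m0) {S Y : Ω → ℕ} (hS : Measurable[𝒜] S) (hY : Measurable[ℬ] Y)
    {B : ℕ} (hB : ∀ ω, Y ω < B) {g : ℕ → ℝ} (hg0 : ∀ s, 0 ≤ g s) (hg1 : ∀ s, g s ≤ 1)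
    {b : ℝ} (hb0 : 0 ≤ b) (hb : betaMixCoeff P 𝒜 ℬ ≤ ENNReal.ofReal b) :
    ∫ ω, g (S ω + Y ω) ∂P ≤ ∫ ω, (∫ ω', g (S ω + Y ω') ∂P) ∂P + b := by
  classical
  have hYm : Measurable Y := hY.mono hℬ le_rfl
  have hset (C : Set ℕ) : MeasurableSet (Y ⁻¹' C) := hYm (MeasurableSet.of_discrete)
  let I : Set ℕ → Ω → ℝ := fun C => (Y ⁻¹' C).indicator (fun _ => (1 : ℝ))
  have hI (C : Set ℕ) : Integrable (I C) P := (integrable_const (1 : ℝ)).indicator (hset C)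
  let q : Set ℕ → Ω → ℝ := fun C => P[I C | 𝒜]
  have hgS (y : ℕ) : StronglyMeasurable[𝒜] (fun ω => g (S ω + y)) :=
    ((measurable_of_countable (fun s => g (s + y))).comp hS).stronglyMeasurable
  have hgbound (s : ℕ) : ‖g s‖ ≤ 1 := by
    rw [Real.norm_eq_abs, abs_of_nonneg (hg0 s)]; exact hg1 s
  have hdecomp (s : ℕ) (ω : Ω) : g (s + Y ω) = ∑ y ∈ Finset.range B, g (s + y) * I {y} ω := by
    rw [Finset.sum_eq_single (Y ω)]
    · simp [I]
    · intro y _ hy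
      simp [I, Ne.symm hy]
    · intro h
      exact absurd (Finset.mem_range.2 (hB ω)) h
  have hint1 (y : ℕ) : Integrable (fun ω => g (S ω + y) * I {y} ω) P :=
    (hI {y}).bdd_mul (((hgS y).mono h𝒜).aestronglyMeasurable)
      (Eventually.of_forall fun ω => hgbound _)
  have hint2 (y : ℕ) : Integrable (fun ω => g (S ω + y) * q {y} ω) P :=
    (integrable_condExp).bdd_mul (((hgS y).mono h𝒜).aestronglyMeasurable)
      (Eventually.of_forall fun ω => hgbound _)
  have hint3 (y : ℕ) : Integrable (fun ω => g (S ω + y) * P.real (Y ⁻¹' {y})) P :=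
    (integrable_const (P.real (Y ⁻¹' {y}))).bdd_mul (((hgS y).mono h𝒜).aestronglyMeasurable)
      (Eventually.of_forall fun ω => hgbound _)
  have h1 : ∫ ω, g (S ω + Y ω) ∂P = ∑ y ∈ Finset.range B, ∫ ω, g (S ω + y) * q {y} ω ∂P := by
    have : ∀ y, ∫ ω, g (S ω + y) * q {y} ω ∂P = ∫ ω, g (S ω + y) * I {y} ω ∂P := by
      intro y
      rw [← integral_condExp h𝒜 (f := fun ω => g (S ω + y) * I {y} ω)]
      exact (integral_congr_ae (condExp_stronglyMeasurable_mul_of_bound h𝒜 (hgS y) (hI {y}) 1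
        (Eventually.of_forall fun ω => hgbound _))).symm
    simp_rw [this]
    rw [← integral_finsetSum _ (fun y _ => hint1 y)]
    exact integral_congr_ae (Eventually.of_forall fun ω => hdecomp _ _)
  have h2 : ∫ ω, (∫ ω', g (S ω + Y ω') ∂P) ∂P =
      ∑ y ∈ Finset.range B, ∫ ω, g (S ω + y) * P.real (Y ⁻¹' {y}) ∂P := by
    rw [← integral_finsetSum _ (fun y _ => hint3 y)]
    refine integral_congr_ae (Eventually.of_forall fun ω => ?_)
    simp only
    rw [integral_congr_ae (Eventually.of_forall fun ω' => hdecomp (S ω) ω'),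
      integral_finsetSum _ (fun y _ => (hI {y}).const_mul _)]
    refine Finset.sum_congr rfl fun y _ => ?_
    rw [integral_const_mul, integral_indicator_const _ (hset {y})]
    simp
  let W : Ω → ℝ := fun ω => ∑ y ∈ Finset.range B, g (S ω + y) * (q {y} ω - P.real (Y ⁻¹' {y}))
  have hWint : Integrable W P := by
    refine integrable_finsetSum _ fun y _ => ?_
    simp_rw [mul_sub]
    exact (hint2 y).sub (hint3 y)
  have hW : ∫ ω, W ω ∂P = ∫ ω, g (S ω + Y ω) ∂P - ∫ ω, (∫ ω', g (S ω + Y ω') ∂P) ∂P := by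
    rw [h1, h2, ← Finset.sum_sub_distrib]
    simp only [W, mul_sub]
    rw [integral_finsetSum]
    · exact Finset.sum_congr rfl fun y _ => integral_sub (hint2 y) (hint3 y)
    · exact fun y _ => (hint2 y).sub (hint3 y)
  have hsum : ∀ᵐ ω ∂P, ∀ C : Finset ℕ, q C ω = ∑ y ∈ C, q {y} ω := by
    rw [ae_all_iff]
    intro C
    have hIC : I C = ∑ y ∈ C, I {y} := by
      ext ω
      simp only [Finset.sum_apply, I, Set.indicator, Set.mem_preimage, Set.mem_singleton_iff,
        Finset.mem_coe, Finset.sum_ite_eq]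
    have := condExp_finsetSum (μ := P) (s := C) (f := fun y => I {y}) (fun y _ => hI {y}) 𝒜
    filter_upwards [this] with ω hω
    simp only [q, hIC]
    rw [hω, Finset.sum_apply]
  let φ : Finset ℕ → {C : Set Ω // MeasurableSet[ℬ] C} :=
    fun C => ⟨Y ⁻¹' C, hY MeasurableSet.of_discrete⟩
  have hle : ∫⁻ ω, ENNReal.ofReal (W ω) ∂P ≤ ENNReal.ofReal b := by
    refine le_trans (lintegral_mono_ae ?_)
      ((le_iSup _ ((Finset.range B).powerset.image φ)).trans hb)
    filter_upwards [hsum] with ω hω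
    let D := (Finset.range B).filter fun y => 0 ≤ q {y} ω - P.real (Y ⁻¹' {y})
    have hD : φ D ∈ (Finset.range B).powerset.image φ :=
      Finset.mem_image_of_mem φ (Finset.mem_powerset.2 (Finset.filter_subset _ _))
    refine le_trans ?_ (le_iSup₂_of_le (φ D) hD le_rfl)
    refine ENNReal.ofReal_le_ofReal ?_
    have hPD : P.real (Y ⁻¹' D) = ∑ y ∈ D, P.real (Y ⁻¹' {y}) := by
      rw [← measureReal_biUnion_finset]
      · congr 1; ext; simp
      · intro y _ y' _ hyy
        exact Disjoint.preimage _ (by simpa using hyy)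
      · exact fun y _ => hset {y}
    calc W ω ≤ ∑ y ∈ D, (q {y} ω - P.real (Y ⁻¹' {y})) := by
          simp only [W, D, Finset.sum_filter]
          refine Finset.sum_le_sum fun y _ => ?_
          split_ifs with h
          · exact mul_le_of_le_one_left h (hg1 _)
          · exact mul_nonpos_of_nonneg_of_nonpos (hg0 _) (not_le.1 h).le
      _ = q D ω - P.real (Y ⁻¹' D) := by rw [Finset.sum_sub_distrib, hPD, hω D]
      _ ≤ |P.real (Y ⁻¹' D) - q D ω| := by rw [abs_sub_comm]; exact le_abs_self _
  have hWb : ∫ ω, W ω ∂P ≤ b := by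
    rw [integral_eq_lintegral_pos_part_sub_lintegral_neg_part hWint]
    have := ENNReal.toReal_mono ENNReal.ofReal_ne_top hle
    rw [ENNReal.toReal_ofReal hb0] at this
    linarith [ENNReal.toReal_nonneg (a := ∫⁻ ω, ENNReal.ofReal (-W ω) ∂P)]
  linarith

/-- Exponential moment bound along a sequence whose successive increments are `β`-mixing: each
step of the induction makes the last increment independent of the earlier ones at cost `b`, after
which it only multiplies the exponential bound on `g` by `E e^{λ Y}`. -/
lemma integral_comp_sum_le_of_mixing {Ω : Type*} [m0 : MeasurableSpace Ω] (P : Measure Ω)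
    [IsProbabilityMeasure P] {Y : ℕ → Ω → ℕ} (hYm : ∀ k, Measurable (Y k)) {B : ℕ}
    (hB : ∀ k ω, Y k ω < B) {b : ℝ}
    (hmix : ∀ k (g : ℕ → ℝ), (∀ s, 0 ≤ g s) → (∀ s, g s ≤ 1) →
      ∫ ω, g ((∑ j ∈ Finset.range k, Y j ω) + Y k ω) ∂P ≤
        ∫ ω, (∫ ω', g ((∑ j ∈ Finset.range k, Y j ω) + Y k ω') ∂P) ∂P + b)
    (lam : ℝ) (k : ℕ) (A : ℝ) (g : ℕ → ℝ) (hg0 : ∀ s, 0 ≤ g s) (hg1 : ∀ s, g s ≤ 1)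
    (hgA : ∀ s : ℕ, g s ≤ A * Real.exp (lam * s)) :
    ∫ ω, g (∑ j ∈ Finset.range k, Y j ω) ∂P ≤
      A * ∏ j ∈ Finset.range k, (∫ ω, Real.exp (lam * Y j ω) ∂P) + k * b := by
  have hint (h : ℕ → ℝ) (k : ℕ) : Integrable (fun ω => h (Y k ω)) P := by
    refine Integrable.of_bound (C := ∑ y ∈ Finset.range B, ‖h y‖)
      ((measurable_of_countable h).comp (hYm k)).aestronglyMeasurable
      (Eventually.of_forall fun ω => ?_)
    exact Finset.single_le_sum (f := fun y => ‖h y‖) (fun _ _ => norm_nonneg _)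
      (Finset.mem_range.2 (hB k ω))
  induction k generalizing A g with
  | zero => simpa using hgA 0
  | succ k ih =>
    simp_rw [Finset.sum_range_succ]
    refine (hmix k g hg0 hg1).trans ?_
    have := ih (A * ∫ ω, Real.exp (lam * Y k ω) ∂P) (fun s => ∫ ω', g (s + Y k ω') ∂P)
      (fun s => integral_nonneg fun ω => hg0 _)
      (fun s => by
        refine (integral_mono (hint (fun y => g (s + y)) k) (integrable_const (1 : ℝ))
          (fun ω => hg1 _)).trans ?_
        simp)
      (fun s => by
        calc ∫ ω', g (s + Y k ω') ∂P
            ≤ ∫ ω', (A * Real.exp (lam * s)) * Real.exp (lam * Y k ω') ∂P := by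
              refine integral_mono (hint (fun y => g (s + y)) k)
                (hint (fun y => (A * Real.exp (lam * s)) * Real.exp (lam * y)) k) fun ω => ?_
              refine (hgA _).trans_eq ?_
              rw [mul_assoc, ← Real.exp_add]; push_cast; ring_nf
          _ = _ := by rw [integral_const_mul]; ring)
    rw [Finset.prod_range_succ]
    push_cast
    linarith

/-! ### Sums over residue classes and a two-sided Chernoff bound -/

/-- A finite sequence continued by zeros, so that sums over a residue class need no bounds. -/
def zeroExtend {n : ℕ} {α : Type*} [Zero α] (F : Fin n → α) (i : ℕ) : α :=
  if h : i < n then F ⟨i, h⟩ else 0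

lemma zeroExtend_of_lt {n : ℕ} {α : Type*} [Zero α] (F : Fin n → α) {i : ℕ} (h : i < n) :
    zeroExtend F i = F ⟨i, h⟩ := dif_pos h

lemma zeroExtend_of_le {n : ℕ} {α : Type*} [Zero α] (F : Fin n → α) {i : ℕ} (h : n ≤ i) :
    zeroExtend F i = 0 := dif_neg (not_lt.2 h)

lemma sum_residue_classes (F : ℕ → ℕ) (n a : ℕ) :
    ∑ r ∈ Finset.range a, ∑ j ∈ Finset.range n, F (r + j * a) =
      ∑ i ∈ Finset.range (n * a), F i := by
  induction n with
  | zero => simp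
  | succ n ih =>
    simp_rw [Finset.sum_range_succ]
    rw [Finset.sum_add_distrib, ih, add_mul, one_mul, Finset.sum_range_add]
    simp_rw [add_comm]

lemma sum_residue_classes_zeroExtend {n : ℕ} (F : Fin n → ℕ) {a : ℕ} (ha : 0 < a) :
    ∑ r ∈ Finset.range a, ∑ j ∈ Finset.range n, zeroExtend F (r + j * a) = ∑ i, F i := by
  rw [sum_residue_classes, ← Finset.sum_subset
    (Finset.range_subset_range.2 (Nat.le_mul_of_pos_right n ha)), Finset.sum_range]
  · exact Finset.sum_congr rfl fun i _ => zeroExtend_of_lt F i.2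
  · intro i _ hi
    exact zeroExtend_of_le F (by simpa using hi)

/-- Each nonempty residue class modulo `a` in `{0, …, n-1}` has at least `n / (2a)` elements; this
holds for `a > n` too, where the nonempty classes are singletons. -/
lemma le_sum_residue_class {n a r : ℕ} (hr : r < a) (hrn : r < n) (m : Fin n → ℕ) {w : ℝ}
    (hw0 : 0 ≤ w) (hw : ∀ i, w ≤ m i) :
    w * (n / (2 * a)) ≤ (∑ j ∈ Finset.range n, zeroExtend m (r + j * a) : ℕ) := by
  have ha : 0 < a := by omega
  -- the indices `j < J` are exactly those with `r + j * a < n`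
  obtain ⟨J, hJ1, hJ2⟩ : ∃ J : ℕ, (∀ j < J, r + j * a < n) ∧ n ≤ r + J * a := by
    have hex : ∃ J, n ≤ r + J * a :=
      ⟨n, (Nat.le_mul_of_pos_right n ha).trans (Nat.le_add_left _ _)⟩
    classical
    exact ⟨Nat.find hex, fun j hj => not_le.1 (Nat.find_min hex hj), Nat.find_spec hex⟩
  have hJpos : 0 < J := by
    rcases Nat.eq_zero_or_pos J with h | h
    · subst h; omega
    · exact h
  have hJn : J ≤ n := by
    have := hJ1 (J - 1) (by omega)
    have h2 := Nat.le_mul_of_pos_right (J - 1) ha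
    omega
  have hcount : (n : ℝ) / (2 * a) ≤ J := by
    rw [div_le_iff₀ (by positivity)]
    have : a ≤ J * a := Nat.le_mul_of_pos_left a hJpos
    have : n ≤ J * (2 * a) := by nlinarith
    exact_mod_cast this
  calc w * (n / (2 * a)) ≤ w * J := by gcongr
    _ = ∑ j ∈ Finset.range J, w := by simp [mul_comm]
    _ ≤ ∑ j ∈ Finset.range J, ((zeroExtend m (r + j * a) : ℕ) : ℝ) := by
        refine Finset.sum_le_sum fun j hj => ?_
        rw [zeroExtend_of_lt m (hJ1 j (Finset.mem_range.1 hj))]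
        exact hw _
    _ ≤ ∑ j ∈ Finset.range n, ((zeroExtend m (r + j * a) : ℕ) : ℝ) :=
        Finset.sum_le_sum_of_subset_of_nonneg (Finset.range_subset_range.2 hJn)
          fun _ _ _ => by positivity
    _ = _ := by push_cast; rfl

section Mixing

variable {Ω : Type*} {n : ℕ} {σ : Fin n → MeasurableSpace Ω} [m0 : MeasurableSpace Ω]
  {P : Measure Ω} [IsProbabilityMeasure P] {Y : Fin n → Ω → ℕ} {m : Fin n → ℕ} {a : ℕ} {b p : ℝ}

/-- Exponential moment bound for a sum over one residue class modulo `a`, whose members are at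
distance at least `a` from each other. -/
lemma integral_comp_residue_class_le (hσ : ∀ i, σ i ≤ m0) (hY : ∀ i, Measurable[σ i] (Y i))
    (hYm : ∀ i ω, Y i ω ≤ m i) (hb0 : 0 ≤ b) (hb : betaMixSeq P σ a ≤ ENNReal.ofReal b)
    {lam : ℝ} (hmgf : ∀ i, ∫ ω, Real.exp (lam * Y i ω) ∂P ≤
      Real.exp (p * (Real.exp lam - 1) * m i))
    (r : ℕ) {A : ℝ} (hA : 0 ≤ A) {g : ℕ → ℝ} (hg0 : ∀ s, 0 ≤ g s) (hg1 : ∀ s, g s ≤ 1)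
    (hgA : ∀ s : ℕ, g s ≤ A * Real.exp (lam * s)) :
    ∫ ω, g (∑ j ∈ Finset.range n, zeroExtend (fun i => Y i ω) (r + j * a)) ∂P ≤
      A * Real.exp (p * (Real.exp lam - 1) *
        (∑ j ∈ Finset.range n, zeroExtend m (r + j * a) : ℕ)) + n * b := by
  let Z : ℕ → Ω → ℕ := fun j ω => zeroExtend (fun i => Y i ω) (r + j * a)
  have hZlt {j : ℕ} (h : r + j * a < n) : Z j = Y ⟨r + j * a, h⟩ :=
    funext fun ω => zeroExtend_of_lt _ h
  have hZge {j : ℕ} (h : n ≤ r + j * a) (ω : Ω) : Z j ω = 0 := zeroExtend_of_le _ h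
  have hZmeas (𝒜 : MeasurableSpace Ω) (j : ℕ) (h𝒜 : ∀ h : r + j * a < n, σ ⟨r + j * a, h⟩ ≤ 𝒜) :
      Measurable[𝒜] (Z j) := by
    by_cases h : r + j * a < n
    · rw [hZlt h]; exact (hY _).mono (h𝒜 h) le_rfl
    · rw [show Z j = fun _ => 0 from funext (hZge (not_lt.1 h))]
      exact measurable_const
  have hZB (j : ℕ) (ω : Ω) : Z j ω < (∑ i, m i) + 1 := by
    by_cases h : r + j * a < n
    · rw [hZlt h, Nat.lt_succ_iff]
      exact (hYm _ ω).trans (Finset.single_le_sum (f := m) (fun _ _ => Nat.zero_le _)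
        (Finset.mem_univ _))
    · rw [hZge (not_lt.1 h)]; omega
  have hmain := integral_comp_sum_le_of_mixing P (Y := Z)
    (fun k => hZmeas m0 k fun h => hσ _) hZB (b := b) (fun k g hg0 hg1 => by
      rcases Nat.eq_zero_or_pos k with rfl | hk
      · simp [hb0]
      by_cases h : r + k * a < n
      · have hk' : r + (k - 1) * a + a = r + k * a := by
          obtain ⟨k, rfl⟩ := Nat.exists_eq_add_of_lt hk
          simp; ring
        have ht : r + (k - 1) * a < n := by omega
        let t : Fin n := ⟨r + (k - 1) * a, ht⟩
        refine integral_comp_add_le_of_betaMixCoeff P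
          (𝒜 := ⨆ (s : Fin n) (_ : s ≤ t), σ s)
          (ℬ := ⨆ (s : Fin n) (_ : (t : ℕ) + a ≤ (s : ℕ)), σ s)
          (iSup₂_le fun i _ => hσ i) (iSup₂_le fun i _ => hσ i)
          (Finset.measurable_fun_sum _ fun j hj => hZmeas _ j fun h' => ?_)
          (hZmeas _ k fun h' => ?_) (hZB k) hg0 hg1 hb0 ((le_iSup _ t).trans hb)
        · refine le_iSup₂_of_le (f := fun (s : Fin n) (_ : s ≤ t) => σ s) _ ?_ le_rfl
          have : j ≤ k - 1 := by have := Finset.mem_range.1 hj; omega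
          exact Fin.mk_le_mk.2 (Nat.add_le_add_left (Nat.mul_le_mul_right a this) r)
        · exact le_iSup₂_of_le (f := fun (s : Fin n) (_ : (t : ℕ) + a ≤ (s : ℕ)) => σ s)
            _ hk'.le le_rfl
      · simp [hZge (not_lt.1 h), hb0])
    lam n A g hg0 hg1 hgA
  refine hmain.trans ?_
  gcongr
  push_cast
  rw [Finset.mul_sum, Real.exp_sum]
  refine Finset.prod_le_prod (fun _ _ => integral_nonneg fun _ => (Real.exp_pos _).le) fun j _ => ?_
  by_cases h : r + j * a < n
  · rw [hZlt h, zeroExtend_of_lt m h]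
    exact hmgf _
  · simp [hZge (not_lt.1 h), zeroExtend_of_le m (not_lt.1 h)]

/-- Chernoff bound over one residue class, for the upper or the lower tail according to the sign of
`lam`. -/
lemma measureReal_residue_class_le (hσ : ∀ i, σ i ≤ m0) (hY : ∀ i, Measurable[σ i] (Y i))
    (hYm : ∀ i ω, Y i ω ≤ m i) (hb0 : 0 ≤ b) (hb : betaMixSeq P σ a ≤ ENNReal.ofReal b)
    {lam : ℝ} (hmgf : ∀ i, ∫ ω, Real.exp (lam * Y i ω) ∂P ≤
      Real.exp (p * (Real.exp lam - 1) * m i))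
    (r : ℕ) {A : ℝ} (hA : 0 ≤ A) {s : Set ℕ} (hs : ∀ k ∈ s, 1 ≤ A * Real.exp (lam * k)) :
    P.real {ω | (∑ j ∈ Finset.range n, zeroExtend (fun i => Y i ω) (r + j * a)) ∈ s} ≤
      A * Real.exp (p * (Real.exp lam - 1) *
        (∑ j ∈ Finset.range n, zeroExtend m (r + j * a) : ℕ)) + n * b := by
  classical
  have hXm : Measurable
      fun ω => ∑ j ∈ Finset.range n, zeroExtend (fun i => Y i ω) (r + j * a) := by
    refine Finset.measurable_fun_sum _ fun j _ => ?_
    by_cases h : r + j * a < n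
    · simp only [zeroExtend_of_lt _ h]; exact (hY _).mono (hσ _) le_rfl
    · simp only [zeroExtend_of_le _ (not_lt.1 h)]; exact measurable_const
  have hset := hXm (MeasurableSet.of_discrete (s := s))
  have h := integral_comp_residue_class_le hσ hY hYm hb0 hb hmgf r hA
    (g := fun k => if k ∈ s then 1 else 0) (fun k => by positivity)
    (fun k => by split_ifs <;> norm_num)
    (fun k => by
      by_cases hk : k ∈ s
      · simpa [hk] using hs k hk
      · simpa [hk] using by positivity)
  refine le_trans (le_of_eq ?_) h
  have := integral_indicator_const (μ := P) (1 : ℝ) hset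
  rw [smul_eq_mul, mul_one] at this
  rw [← Set.preimage, ← this]
  rfl

/-- Two-sided Chernoff bound for a sum of counts with `β`-mixing dependence: a deviation of the
total forces a deviation in one of the `a` residue classes, and within a class the counts are
independent up to the mixing error `b` per summand. -/
lemma measureReal_count_deviation_le (hσ : ∀ i, σ i ≤ m0) (hY : ∀ i, Measurable[σ i] (Y i))
    (hYm : ∀ i ω, Y i ω ≤ m i) (hb0 : 0 ≤ b) (hb : betaMixSeq P σ a ≤ ENNReal.ofReal b)
    (hmgf : ∀ (lam : ℝ) i, ∫ ω, Real.exp (lam * Y i ω) ∂P ≤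
      Real.exp (p * (Real.exp lam - 1) * m i))
    (ha : 0 < a) {plo phi μ : ℝ} (hplo : 0 ≤ plo) (hp1 : plo ≤ p) (hp2 : p ≤ phi)
    (hμ : ∀ r < a, r < n → μ ≤ (∑ j ∈ Finset.range n, zeroExtend m (r + j * a) : ℕ)) :
    P.real {ω | ¬ (plo / 4 * (∑ i, m i : ℕ) ≤ (∑ i, Y i ω : ℕ) ∧
        ((∑ i, Y i ω : ℕ) : ℝ) ≤ 3 * phi * (∑ i, m i : ℕ))} ≤
      a * (2 * Real.exp (-(plo * μ / 4)) + 2 * (n * b)) := by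
  let X : ℕ → Ω → ℕ := fun r ω => ∑ j ∈ Finset.range n, zeroExtend (fun i => Y i ω) (r + j * a)
  let M : ℕ → ℕ := fun r => ∑ j ∈ Finset.range n, zeroExtend m (r + j * a)
  have hXsum (ω : Ω) : ∑ r ∈ Finset.range a, X r ω = ∑ i, Y i ω :=
    sum_residue_classes_zeroExtend _ ha
  have hMsum : ∑ r ∈ Finset.range a, M r = ∑ i, m i := sum_residue_classes_zeroExtend _ ha
  have hsub : {ω | ¬ (plo / 4 * (∑ i, m i : ℕ) ≤ (∑ i, Y i ω : ℕ) ∧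
        ((∑ i, Y i ω : ℕ) : ℝ) ≤ 3 * phi * (∑ i, m i : ℕ))} ⊆
      ⋃ r ∈ Finset.range a, ({ω | X r ω ∈ {s : ℕ | (s : ℝ) < plo / 4 * M r}} ∪
        {ω | X r ω ∈ {s : ℕ | 3 * phi * M r < s}}) := by
    intro ω hω
    by_contra hcon
    simp only [Set.mem_iUnion, not_exists, Set.mem_union, not_or, Set.mem_ofPred_eq, not_lt] at hcon
    refine hω ⟨?_, ?_⟩
    · rw [← hXsum, ← hMsum]
      push_cast
      rw [Finset.mul_sum]
      exact Finset.sum_le_sum fun r hr => (hcon r hr).1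
    · rw [← hXsum, ← hMsum]
      push_cast
      rw [Finset.mul_sum]
      exact Finset.sum_le_sum fun r hr => (hcon r hr).2
  have hnb : 0 ≤ n * b := by positivity
  have hp0 : 0 ≤ p := hplo.trans hp1
  have hone (r : ℕ) (hr : r ∈ Finset.range a) :
      P.real ({ω | X r ω ∈ {s : ℕ | (s : ℝ) < plo / 4 * M r}} ∪
        {ω | X r ω ∈ {s : ℕ | 3 * phi * M r < s}}) ≤
      2 * Real.exp (-(plo * μ / 4)) + 2 * (n * b) := by
    by_cases hrn : r < n
    · have hM : μ ≤ M r := hμ r (Finset.mem_range.1 hr) hrn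
      have hM0 : (0 : ℝ) ≤ M r := Nat.cast_nonneg _
      have hexp : Real.exp (-(plo * M r / 4)) ≤ Real.exp (-(plo * μ / 4)) := by gcongr
      have hpM : plo * M r ≤ p * M r := by gcongr
      have hpM' : p * M r ≤ phi * M r := by gcongr
      have hpM0 : 0 ≤ plo * M r := by positivity
      have hlow : P.real {ω | X r ω ∈ {s : ℕ | (s : ℝ) < plo / 4 * M r}} ≤
          Real.exp (-(plo * M r / 4)) + n * b := by
        refine (measureReal_residue_class_le hσ hY hYm hb0 hb (hmgf (-1)) r
          (A := Real.exp (plo / 4 * M r)) (Real.exp_pos _).le (fun k hk => ?_)).trans ?_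
        · rw [← Real.exp_add]
          refine Real.one_le_exp ?_
          have : (k : ℝ) < plo / 4 * M r := hk
          linarith
        · gcongr
          rw [← Real.exp_add]
          refine Real.exp_le_exp.2 ?_
          have he : Real.exp (-1) ≤ 1 / 2 := by
            have := Real.exp_neg_one_lt_half
            linarith
          have : p * (Real.exp (-1) - 1) * M r ≤ - (p * M r) / 2 := by
            nlinarith [mul_nonneg hp0 hM0]
          change plo / 4 * M r + p * (Real.exp (-1) - 1) * M r ≤ _
          linarith
      have hup : P.real {ω | X r ω ∈ {s : ℕ | 3 * phi * M r < s}} ≤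
          Real.exp (-(plo * M r / 4)) + n * b := by
        refine (measureReal_residue_class_le hσ hY hYm hb0 hb (hmgf 1) r
          (A := Real.exp (-(3 * phi * M r))) (Real.exp_pos _).le (fun k hk => ?_)).trans ?_
        · rw [← Real.exp_add]
          refine Real.one_le_exp ?_
          have : 3 * phi * M r < (k : ℝ) := hk
          linarith
        · gcongr
          rw [← Real.exp_add]
          refine Real.exp_le_exp.2 ?_
          have he : Real.exp 1 ≤ 3 := by
            have := Real.exp_one_lt_d9
            linarith
          have : p * (Real.exp 1 - 1) * M r ≤ 2 * (p * M r) := by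
            nlinarith [mul_nonneg hp0 hM0]
          change -(3 * phi * M r) + p * (Real.exp 1 - 1) * M r ≤ _
          linarith
      linarith [measureReal_union_le (μ := P) {ω | X r ω ∈ {s : ℕ | (s : ℝ) < plo / 4 * M r}}
        {ω | X r ω ∈ {s : ℕ | 3 * phi * M r < s}}]
    · have hX0 (ω : Ω) : X r ω = 0 := Finset.sum_eq_zero fun j _ =>
        zeroExtend_of_le _ ((not_lt.1 hrn).trans (Nat.le_add_right _ _))
      have hM0 : M r = 0 := Finset.sum_eq_zero fun j _ =>
        zeroExtend_of_le _ ((not_lt.1 hrn).trans (Nat.le_add_right _ _))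
      simp only [hX0, hM0, Set.mem_ofPred_eq, Nat.cast_zero, mul_zero, lt_self_iff_false,
        Set.ofPred_false, Set.union_self, measureReal_empty]
      positivity
  refine (measureReal_mono hsub (measure_ne_top P _)).trans
    ((measureReal_biUnion_finset_le _ _).trans ?_)
  refine (Finset.sum_le_card_nsmul _ _ _ hone).trans_eq ?_
  rw [Finset.card_range, nsmul_eq_mul]

end Mixing

/-! ### Grid cells and the number of design points in them -/

/-- The closed cell with index `u` of the grid of mesh `1 / R`. Neighbouring cells share their
boundary, and the cells with `u k < R` cover the closed unit cube. -/
def gridCell {d : ℕ} (R : ℕ) (u : Fin d → ℕ) : Set (Euc d) :=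
  {z | ∀ k, z k ∈ Set.Icc ((u k : ℝ) / R) ((u k + 1 : ℝ) / R)}

/-- The indices of the `R ^ d` cells that cover the unit cube. -/
def gridIndex (d R : ℕ) : Finset (Fin d → ℕ) := Fintype.piFinset fun _ => Finset.range R

lemma card_gridIndex (d R : ℕ) : (gridIndex d R).card = R ^ d := by
  simp [gridIndex]

lemma setOf_forall_mem_Icc_eq_preimage {d : ℕ} (s t : Fin d → ℝ) :
    {z : Euc d | ∀ k, z k ∈ Set.Icc (s k) (t k)} = WithLp.ofLp ⁻¹' Set.Icc s t := by
  ext z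
  simp [Set.mem_Icc, Pi.le_def, forall_and]

lemma measurableSet_gridCell {d : ℕ} (R : ℕ) (u : Fin d → ℕ) : MeasurableSet (gridCell R u) := by
  rw [gridCell, setOf_forall_mem_Icc_eq_preimage (fun k => (u k : ℝ) / R)
    (fun k => (u k + 1 : ℝ) / R)]
  exact (PiLp.volume_preserving_ofLp (Fin d)).measurable measurableSet_Icc

lemma measurableSet_unitCube (d : ℕ) : MeasurableSet (unitCube d) := by
  rw [unitCube, setOf_forall_mem_Icc_eq_preimage (fun _ => 0) (fun _ => 1)]
  exact (PiLp.volume_preserving_ofLp (Fin d)).measurable measurableSet_Icc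

lemma volume_gridCell {d : ℕ} (R : ℕ) (u : Fin d → ℕ) :
    volume (gridCell R u) = ENNReal.ofReal ((1 / (R : ℝ)) ^ d) := by
  rw [gridCell, setOf_forall_mem_Icc_eq_preimage (fun k => (u k : ℝ) / R)
    (fun k => (u k + 1 : ℝ) / R), (PiLp.volume_preserving_ofLp (Fin d)).measure_preimage
    measurableSet_Icc.nullMeasurableSet, Real.volume_Icc_pi,
    ENNReal.ofReal_pow (by positivity)]
  simp_rw [← sub_div, add_sub_cancel_left]
  simp

lemma gridCell_subset_unitCube {d R : ℕ} {u : Fin d → ℕ} (hu : u ∈ gridIndex d R) :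
    gridCell R u ⊆ unitCube d := by
  intro z hz k
  have hk : u k < R := Finset.mem_range.1 (Fintype.mem_piFinset.1 hu k)
  have hR : (0 : ℝ) < R := by exact_mod_cast (Nat.zero_le _).trans_lt hk
  refine ⟨le_trans (by positivity) (hz k).1, (hz k).2.trans ?_⟩
  rw [div_le_one hR]
  exact_mod_cast hk

lemma exists_mem_gridCell {d R : ℕ} (hR : 0 < R) {z : Euc d} (hz : z ∈ unitCube d) :
    ∃ u ∈ gridIndex d R, z ∈ gridCell R u := by
  have hR' : (0 : ℝ) < R := by exact_mod_cast hR
  -- the minimum puts the coordinate `1` into the last cell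
  refine ⟨fun k => min ⌊R * z k⌋₊ (R - 1), ?_, fun k => ?_⟩
  · refine Fintype.mem_piFinset.2 fun k => Finset.mem_range.2 ?_
    exact (min_le_right _ _).trans_lt (by omega)
  · have h0 : 0 ≤ R * z k := mul_nonneg hR'.le (hz k).1
    have h1 : R * z k ≤ R := by nlinarith [(hz k).2]
    rw [Set.mem_Icc, div_le_iff₀ hR', le_div_iff₀ hR', mul_comm (z k)]
    refine ⟨le_trans (by exact_mod_cast min_le_left _ _) (Nat.floor_le h0), ?_⟩
    dsimp only
    rcases le_total ⌊R * z k⌋₊ (R - 1) with h | h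
    · rw [min_eq_left h]; exact (Nat.lt_floor_add_one _).le
    · rw [min_eq_right h]
      push_cast [Nat.cast_sub hR]
      linarith

lemma dist_le_of_mem_gridCell {d R : ℕ} (hR : 0 < R) {u : Fin d → ℕ} {z w : Euc d}
    (hz : z ∈ gridCell R u) (hw : w ∈ gridCell R u) : dist z w ≤ √d / R := by
  have hR' : (0 : ℝ) < R := by exact_mod_cast hR
  rw [EuclideanSpace.dist_eq]
  have hk (k : Fin d) : dist (z k) (w k) ^ 2 ≤ (1 / (R : ℝ)) ^ 2 := by
    gcongr
    rw [Real.dist_eq, abs_le]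
    have h1 := hz k
    have h2 := hw k
    simp only [Set.mem_Icc, add_div] at h1 h2
    constructor <;> linarith [h1.1, h1.2, h2.1, h2.2]
  calc √(∑ k, dist (z k) (w k) ^ 2) ≤ √(d * (1 / (R : ℝ)) ^ 2) := by
        refine Real.sqrt_le_sqrt ((Finset.sum_le_card_nsmul _ _ _ fun k _ => hk k).trans_eq ?_)
        simp
    _ = √d / R := by
        rw [Real.sqrt_mul (by positivity), Real.sqrt_sq (by positivity), mul_one_div]

/-- The cells that meet a ball of radius `√d / R` lie within `d + 1` of the cell of its centre in
each coordinate, so there are at most `(2 d + 3) ^ d` of them. -/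
lemma exists_finset_gridIndex_cover {d R : ℕ} (hR : 0 < R) {z : Euc d} (hz : z ∈ unitCube d) :
    ∃ T ⊆ gridIndex d R, T.card ≤ (2 * d + 3) ^ d ∧
      ∀ w ∈ unitCube d, dist z w ≤ √d / R → ∃ t ∈ T, w ∈ gridCell R t := by
  have hR' : (0 : ℝ) < R := by exact_mod_cast hR
  obtain ⟨u, hu, hzu⟩ := exists_mem_gridCell hR hz
  classical
  refine ⟨(Fintype.piFinset fun k => Finset.Icc (u k - (d + 1)) (u k + (d + 1))) ∩ gridIndex d R,
    Finset.inter_subset_right, ?_, fun w hw hd => ?_⟩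
  · refine (Finset.card_le_card Finset.inter_subset_left).trans ?_
    rw [Fintype.card_piFinset]
    refine (Finset.prod_le_pow_card _ _ (2 * d + 3) fun k _ => ?_).trans (by simp)
    rw [Nat.card_Icc]; omega
  · obtain ⟨t, ht, hwt⟩ := exists_mem_gridCell hR hw
    refine ⟨t, Finset.mem_inter.2 ⟨Fintype.mem_piFinset.2 fun k => ?_, ht⟩, hwt⟩
    have hd1 : (1 : ℝ) ≤ d := by exact_mod_cast (Nat.zero_le _).trans_lt k.2
    have hsq : √(d : ℝ) ≤ d := by
      rw [Real.sqrt_le_left (by positivity)]; nlinarith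
    have hk : |z k - w k| ≤ d / R := by
      have h0 : |z k - w k| ≤ dist z w := by
        rw [dist_eq_norm]; exact PiLp.norm_apply_le (z - w) k
      exact (h0.trans hd).trans (by gcongr)
    have h1 := hzu k
    have h2 := hwt k
    rw [Set.mem_Icc, div_le_iff₀ hR', le_div_iff₀ hR'] at h1 h2
    rw [le_div_iff₀ hR'] at hk
    rw [← abs_of_pos hR', ← abs_mul] at hk
    have hk' := abs_le.1 hk
    have e1 : (u k : ℝ) ≤ t k + (d + 1) := by nlinarith
    have e2 : (t k : ℝ) ≤ u k + (d + 1) := by nlinarith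
    have e1' : u k ≤ t k + (d + 1) := by exact_mod_cast e1
    have e2' : t k ≤ u k + (d + 1) := by exact_mod_cast e2
    exact Finset.mem_Icc.2 ⟨by omega, e2'⟩

section Design

variable {Ω : Type*} [MeasurableSpace Ω] {P : Measure Ω} {d n : ℕ}
  {m : Fin n → ℕ} {x : (i : Fin n) → Fin (m i) → Ω → Euc d} {v : Euc d → ℝ}
  {vmin vmax Cβ c C : ℝ}

lemma DesignAssumption.measure_mem_compl_unitCube (h : DesignAssumption P m x v vmin vmax Cβ c C)
    (i : Fin n) (j : Fin (m i)) : P {ω | x i j ω ∉ unitCube d} = 0 := by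
  have hs := (measurableSet_unitCube d).compl
  have : P {ω | x i j ω ∉ unitCube d} = P.map (x i j) (unitCube d)ᶜ := by
    rw [Measure.map_apply (h.measurable i j) hs]; rfl
  rw [this, h.law, withDensity_apply _ hs, Measure.restrict_restrict hs]
  simp

/-- An upper bound that needs no measurability of `A`. -/
lemma DesignAssumption.measure_mem_le (h : DesignAssumption P m x v vmin vmax Cβ c C)
    (i : Fin n) (j : Fin (m i)) (A : Set (Euc d)) :
    P {ω | x i j ω ∈ A} ≤ ENNReal.ofReal vmax * volume A := by
  have hs := measurableSet_toMeasurable volume A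
  calc P {ω | x i j ω ∈ A} ≤ P (x i j ⁻¹' toMeasurable volume A) :=
        measure_mono fun ω hω => subset_toMeasurable volume A hω
    _ = P.map (x i j) (toMeasurable volume A) := (Measure.map_apply (h.measurable i j) hs).symm
    _ = ∫⁻ z in toMeasurable volume A ∩ unitCube d, ENNReal.ofReal (v z) := by
        rw [h.law, withDensity_apply _ hs, Measure.restrict_restrict hs]
    _ ≤ ∫⁻ _ in toMeasurable volume A ∩ unitCube d, ENNReal.ofReal vmax :=
        setLIntegral_mono measurable_const fun z hz =>
          ENNReal.ofReal_le_ofReal (h.density_bounds z hz.2).2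
    _ ≤ ENNReal.ofReal vmax * volume A := by
        rw [setLIntegral_const]
        exact mul_le_mul' le_rfl
          ((measure_mono Set.inter_subset_left).trans (measure_toMeasurable A).le)

lemma DesignAssumption.le_measure_mem (h : DesignAssumption P m x v vmin vmax Cβ c C)
    (i : Fin n) (j : Fin (m i)) {A : Set (Euc d)} (hA : MeasurableSet A) (hAu : A ⊆ unitCube d) :
    ENNReal.ofReal vmin * volume A ≤ P {ω | x i j ω ∈ A} := by
  have : P {ω | x i j ω ∈ A} = P.map (x i j) A := by
    rw [Measure.map_apply (h.measurable i j) hA]; rfl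
  rw [this, h.law, withDensity_apply _ hA, Measure.restrict_restrict hA,
    Set.inter_eq_left.2 hAu, ← setLIntegral_const]
  exact setLIntegral_mono_ae' hA (Eventually.of_forall fun z hz =>
    ENNReal.ofReal_le_ofReal (h.density_bounds z (hAu hz)).1)

open Classical in
lemma DesignAssumption.integral_exp_count_le [IsProbabilityMeasure P]
    (h : DesignAssumption P m x v vmin vmax Cβ c C) {A : Set (Euc d)} (hA : MeasurableSet A) {p : ℝ}
    (hp : ∀ i j, P.real {ω | x i j ω ∈ A} = p) (lam : ℝ) (i : Fin n) :
    ∫ ω, Real.exp (lam * (∑ j, if x i j ω ∈ A then 1 else 0 : ℕ)) ∂P ≤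
      Real.exp (p * (Real.exp lam - 1) * m i) := by
  let φ : Euc d → ℝ := fun z => Real.exp (lam * if z ∈ A then 1 else 0)
  have hφ : Measurable φ := by
    refine (Measurable.ite hA measurable_const measurable_const).const_mul lam |>.exp
  have h1 (ω : Ω) : Real.exp (lam * (∑ j, if x i j ω ∈ A then 1 else 0 : ℕ)) =
      ∏ j, φ (x i j ω) := by
    rw [← Real.exp_sum, ← Finset.mul_sum]
    push_cast
    rfl
  simp_rw [h1]
  rw [(h.indep i).integral_fun_prod_comp (f := fun _ => φ)
    (fun j => (h.measurable i j).aemeasurable) (fun j => hφ.aestronglyMeasurable)]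
  have h2 (j : Fin (m i)) : ∫ ω, φ (x i j ω) ∂P = 1 + p * (Real.exp lam - 1) := by
    have hs : MeasurableSet {ω | x i j ω ∈ A} := h.measurable i j hA
    have h3 (ω : Ω) : φ (x i j ω) =
        1 + {ω | x i j ω ∈ A}.indicator (fun _ => Real.exp lam - 1) ω := by
      by_cases hω : x i j ω ∈ A <;> simp [φ, hω]
    simp_rw [h3]
    rw [integral_add (integrable_const _) ((integrable_const _).indicator hs),
      integral_indicator_const _ hs, hp]
    simp
  simp_rw [h2]
  rw [Finset.prod_const, Finset.card_univ, Fintype.card_fin, mul_comm _ (m i : ℝ), Real.exp_nat_mul]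
  rcases Nat.eq_zero_or_pos (m i) with h0 | h0
  · simp [h0]
  have : 0 ≤ 1 + p * (Real.exp lam - 1) := by
    rw [← h2 ⟨0, h0⟩]
    exact integral_nonneg fun ω => (Real.exp_pos _).le
  gcongr
  linarith [Real.add_one_le_exp (p * (Real.exp lam - 1))]

open Classical in
/-- Concentration of the number of design points in one grid cell. -/
lemma DesignAssumption.measureReal_cell_deviation_le [IsProbabilityMeasure P]
    (h : DesignAssumption P m x v vmin vmax Cβ c C) (hvmin : 0 < vmin)
    (hvmax : 0 < vmax) (hw : 0 ≤ c * harmonicMean m) {R a : ℕ} (ha : 0 < a) {u : Fin d → ℕ}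
    (hu : u ∈ gridIndex d R) :
    P.real {ω | ¬ (vmin * (1 / (R : ℝ)) ^ d / 4 * (∑ i, m i : ℕ) ≤
          (Finset.univ.filter fun q : (i : Fin n) × Fin (m i) => x q.1 q.2 ω ∈ gridCell R u).card ∧
        ((Finset.univ.filter fun q : (i : Fin n) × Fin (m i) =>
          x q.1 q.2 ω ∈ gridCell R u).card : ℝ) ≤
          3 * (vmax * (1 / (R : ℝ)) ^ d) * (∑ i, m i : ℕ))} ≤
      a * (2 * Real.exp (-(vmin * (1 / (R : ℝ)) ^ d * (c * harmonicMean m * (n / (2 * a))) / 4)) +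
        2 * (n * Real.exp (-Cβ * a))) := by
  have hA := measurableSet_gridCell R u
  -- all points have the same law, so the cell has one probability `p`
  let ν := (volume.restrict (unitCube d)).withDensity (fun z => ENNReal.ofReal (v z))
  have hp (i : Fin n) (j : Fin (m i)) :
      P.real {ω | x i j ω ∈ gridCell R u} = ν.real (gridCell R u) := by
    rw [measureReal_def, measureReal_def, show ν = _ from (h.law i j).symm,
      Measure.map_apply (h.measurable i j) hA]
    rfl
  rcases Nat.eq_zero_or_pos n with hn | hn
  · subst hn
    simp only [Finset.univ_eq_empty, Finset.sum_empty]
    refine le_trans (le_of_eq ?_) (by positivity : (0 : ℝ) ≤ _)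
    simp
  have hm0 := h.pos ⟨0, hn⟩
  have hplo : vmin * (1 / (R : ℝ)) ^ d ≤ ν.real (gridCell R u) := by
    rw [← hp ⟨0, hn⟩ ⟨0, hm0⟩]
    have := ENNReal.toReal_mono (measure_ne_top P _)
      (h.le_measure_mem ⟨0, hn⟩ ⟨0, hm0⟩ hA (gridCell_subset_unitCube hu))
    rwa [volume_gridCell, ← ENNReal.ofReal_mul hvmin.le, ENNReal.toReal_ofReal (by positivity)]
      at this
  have hphi : ν.real (gridCell R u) ≤ vmax * (1 / (R : ℝ)) ^ d := by
    rw [← hp ⟨0, hn⟩ ⟨0, hm0⟩]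
    have := h.measure_mem_le ⟨0, hn⟩ ⟨0, hm0⟩ (gridCell R u)
    rw [volume_gridCell, ← ENNReal.ofReal_mul hvmax.le] at this
    exact ENNReal.toReal_le_of_le_ofReal (by positivity) this
  have hcard (ω : Ω) :
      (Finset.univ.filter fun q : (i : Fin n) × Fin (m i) => x q.1 q.2 ω ∈ gridCell R u).card =
        ∑ i, ∑ j, if x i j ω ∈ gridCell R u then 1 else 0 := by
    rw [Finset.card_filter, Fintype.sum_sigma]
  simp_rw [hcard]
  have hσle (i : Fin n) :
      (⨆ j, MeasurableSpace.comap (x i j) inferInstance) ≤ ‹MeasurableSpace Ω› :=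
    iSup_le fun j => (h.measurable i j).comap_le
  refine measureReal_count_deviation_le
    (σ := fun i => ⨆ j, MeasurableSpace.comap (x i j) inferInstance)
    (Y := fun i ω => ∑ j, if x i j ω ∈ gridCell R u then 1 else 0) hσle
    (fun i => ?_) (fun i ω => ?_) (Real.exp_pos _).le (h.mixing a)
    (fun lam i => h.integral_exp_count_le hA hp lam i) ha (by positivity) hplo hphi
    (fun r hr hrn => le_sum_residue_class hr hrn m hw fun i => (h.comparable i).1)
  · refine Finset.measurable_fun_sum _ fun j _ => ?_
    refine Measurable.ite ?_ measurable_const measurable_const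
    exact le_iSup (fun j => MeasurableSpace.comap (x i j) inferInstance) j _ ⟨_, hA, rfl⟩
  · refine (Finset.sum_le_card_nsmul _ _ 1 fun j _ => ?_).trans (by simp)
    split_ifs <;> omega

end Design

/-! ### Total variation of the nearest neighbour graph -/

lemma convex_unitCube (d : ℕ) : Convex ℝ (unitCube d) := by
  intro z hz w hw s t hs ht hst k
  have := (convex_Icc (0 : ℝ) 1) (hz k) (hw k) hs ht hst
  simpa using this

/-- The points where the Lipschitz bound at distance `ε` from the exceptional set is unavailable. -/
def badRegion (d : ℕ) (S : Set (Euc d)) (ε : ℝ) : Set (Euc d) :=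
  nbhd ε S ∪ (unitCube d \ innerCube d ε)

/-- Outside the `2δ`-bad region, a segment of length at most `δ` avoids the `δ`-bad region, hence
stays in one connected component and the Lipschitz bound applies to its end points. -/
lemma IsPiecewiseLipschitzOff.abs_sub_le {d : ℕ} {f : Euc d → ℝ} {S : Set (Euc d)}
    {C_f C_S ε₀ L δ : ℝ} (hf : IsPiecewiseLipschitzOff f S C_f C_S ε₀ L) (hL : 0 ≤ L)
    (hδ : 0 < δ) (hδε : 2 * δ < ε₀) {z w : Euc d} (hz : z ∈ unitCube d) (hw : w ∈ unitCube d)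
    (hzb : z ∉ badRegion d S (2 * δ)) (hzw : dist z w ≤ δ) : |f z - f w| ≤ L * δ := by
  have hzS : z ∉ nbhd (2 * δ) S := fun h => hzb (Or.inl h)
  have hzI : z ∈ innerCube d (2 * δ) := by
    by_contra h
    exact hzb (Or.inr ⟨hz, h⟩)
  have hseg : segment ℝ z w ⊆ innerCube d δ \ nbhd δ S := by
    intro y hy
    have hd : dist z y ≤ δ := by
      have h1 := dist_add_dist_of_mem_segment hy
      linarith [dist_nonneg (x := y) (y := w)]
    have hstep {A : Set (Euc d)} (h : z ∉ nbhd (2 * δ) A) : y ∉ nbhd δ A := by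
      rintro ⟨a, ha, hya⟩
      exact h ⟨a, ha, by linarith [dist_triangle z y a]⟩
    exact ⟨⟨(convex_unitCube d).segment_subset hz hw hy, hstep hzI.2⟩, hstep hzS⟩
  have hconn := (convex_segment z w).isPreconnected.subset_connectedComponentIn
    (left_mem_segment ℝ z w) hseg
  refine (hf.lipschitz δ hδ (by linarith) z (hseg (left_mem_segment ℝ z w)) w
    (hconn (right_mem_segment ℝ z w))).trans ?_
  gcongr

section Graph

variable {V : Type*} [Fintype V] {d K R : ℕ} {y : V → Euc d}

open Classical in
lemma dist_le_of_isKNearest (hR : 0 < R) (hy : ∀ p, y p ∈ unitCube d)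
    (hlow : ∀ u ∈ gridIndex d R, K + 1 ≤ (Finset.univ.filter fun q => y q ∈ gridCell R u).card)
    {p q : V} (hpq : IsKNearest K y p q) : dist (y p) (y q) ≤ √d / R := by
  by_contra! hlt
  obtain ⟨u, hu, hpu⟩ := exists_mem_gridCell hR (hy p)
  let T := (Finset.univ.filter fun q => y q ∈ gridCell R u).erase p
  have hT : K ≤ T.card := by
    have hpT : p ∈ Finset.univ.filter fun q => y q ∈ gridCell R u :=
      Finset.mem_filter.2 ⟨Finset.mem_univ _, hpu⟩
    rw [Finset.card_erase_of_mem hpT]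
    have := hlow u hu
    omega
  have hsub : (T : Set V) ⊆ {r | r ≠ p ∧ dist (y p) (y r) < dist (y p) (y q)} := by
    intro r hr
    obtain ⟨h1, h2⟩ := Finset.mem_erase.1 (Finset.mem_coe.1 hr)
    exact ⟨h1, (dist_le_of_mem_gridCell hR hpu (Finset.mem_filter.1 h2).2).trans_lt hlt⟩
  have := Set.ncard_le_ncard hsub (Set.toFinite _)
  rw [Set.ncard_coe_finset] at this
  unfold IsKNearest at hpq
  omega

open Classical in
lemma card_filter_dist_le (hR : 0 < R) (hy : ∀ p, y p ∈ unitCube d) {U : ℝ}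
    (hup : ∀ u ∈ gridIndex d R, ((Finset.univ.filter fun q => y q ∈ gridCell R u).card : ℝ) ≤ U)
    (hU : 0 ≤ U) (p : V) :
    ((Finset.univ.filter fun q => dist (y p) (y q) ≤ √d / R).card : ℝ) ≤ (2 * d + 3) ^ d * U := by
  obtain ⟨T, hT, hcard, hcov⟩ := exists_finset_gridIndex_cover hR (hy p)
  have hsub : (Finset.univ.filter fun q => dist (y p) (y q) ≤ √d / R) ⊆
      T.biUnion fun t => Finset.univ.filter fun q => y q ∈ gridCell R t := by
    intro q hq
    obtain ⟨t, ht, hqt⟩ := hcov (y q) (hy q) (Finset.mem_filter.1 hq).2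
    exact Finset.mem_biUnion.2 ⟨t, ht, Finset.mem_filter.2 ⟨Finset.mem_univ _, hqt⟩⟩
  have h1 := (Finset.card_le_card hsub).trans Finset.card_biUnion_le
  calc ((Finset.univ.filter fun q => dist (y p) (y q) ≤ √d / R).card : ℝ)
      ≤ ∑ t ∈ T, ((Finset.univ.filter fun q => y q ∈ gridCell R t).card : ℝ) := by exact_mod_cast h1
    _ ≤ T.card * U := by
        rw [← nsmul_eq_mul]
        exact Finset.sum_le_card_nsmul _ _ _ fun t ht => hup t (hT ht)
    _ ≤ (2 * d + 3) ^ d * U := by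
        gcongr
        exact_mod_cast hcard

open Classical in
/-- The deterministic core: when each grid cell holds more than `K` and at most `U` points, edges
are no longer than the diameter `√d / R` of a cell and degrees are of order `U`, so the total
variation is controlled by the number of points and the number of points in the bad region. -/
lemma graphTV_knnGraph_le (hd : 1 ≤ d) (hR : 0 < R) (hy : ∀ p, y p ∈ unitCube d)
    {f : Euc d → ℝ} {S : Set (Euc d)} {C_f C_S ε₀ L U : ℝ}
    (hf : IsPiecewiseLipschitzOff f S C_f C_S ε₀ L) (hL : 0 ≤ L) (hCf : 0 ≤ C_f)
    (hε : 2 * (√d / R) < ε₀)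
    (hlow : ∀ u ∈ gridIndex d R, K + 1 ≤ (Finset.univ.filter fun q => y q ∈ gridCell R u).card)
    (hup : ∀ u ∈ gridIndex d R, ((Finset.univ.filter fun q => y q ∈ gridCell R u).card : ℝ) ≤ U)
    (hU : 0 ≤ U) :
    graphTV (knnGraph K y) (fun p => f (y p)) ≤ (2 * d + 3) ^ d * U *
      (Fintype.card V * (L * (√d / R)) + 2 * C_f *
        (Finset.univ.filter fun p => y p ∈ badRegion d S (2 * (√d / R))).card) := by
  set δ : ℝ := √d / R
  have hδ : 0 < δ := by
    have : (0 : ℝ) < d := by exact_mod_cast hd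
    positivity
  let w : V → ℝ := fun p => L * δ + 2 * C_f * (if y p ∈ badRegion d S (2 * δ) then 1 else 0)
  have hw (p : V) : 0 ≤ w p := by positivity
  have hedge (p q : V) (h : (knnGraph K y).Adj p q) : dist (y p) (y q) ≤ δ := by
    rcases h.2 with h | h
    · exact dist_le_of_isKNearest hR hy hlow h
    · rw [dist_comm]; exact dist_le_of_isKNearest hR hy hlow h
  have habs (p q : V) (h : dist (y p) (y q) ≤ δ) : |f (y p) - f (y q)| ≤ w p := by
    by_cases hb : y p ∈ badRegion d S (2 * δ)
    · have h1 := hf.bounded _ (hy p)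
      have h2 := hf.bounded _ (hy q)
      have h3 := abs_sub (f (y p)) (f (y q))
      have h4 : 0 ≤ L * δ := by positivity
      simp only [w, hb, if_true]
      linarith
    · simp only [w, hb, if_false, mul_zero, add_zero]
      exact hf.abs_sub_le hL hδ hε (hy p) (hy q) hb h
  -- count each edge through a representative ordered pair
  have hout (e : Sym2 V) : s((Quot.out e).1, (Quot.out e).2) = e := Quot.out_eq e
  have hadj (e : Sym2 V) (he : e ∈ (knnGraph K y).edgeFinset) :
      dist (y (Quot.out e).1) (y (Quot.out e).2) ≤ δ := by
    refine hedge _ _ ?_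
    rw [← SimpleGraph.mem_edgeSet, hout]
    exact SimpleGraph.mem_edgeFinset.1 he
  calc graphTV (knnGraph K y) (fun p => f (y p))
      ≤ ∑ e ∈ (knnGraph K y).edgeFinset, w (Quot.out e).1 := by
        refine Finset.sum_le_sum fun e he => ?_
        conv_lhs => rw [← hout e]
        exact habs _ _ (hadj e he)
    _ = ∑ z ∈ (knnGraph K y).edgeFinset.image fun e : Sym2 V => Quot.out e, w z.1 := by
        rw [Finset.sum_image]
        intro e _ e' _ hee
        rw [← hout e, ← hout e']
        exact congrArg (fun z : V × V => s(z.1, z.2)) hee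
    _ ≤ ∑ z ∈ Finset.univ.filter fun z : V × V => dist (y z.1) (y z.2) ≤ δ, w z.1 := by
        refine Finset.sum_le_sum_of_subset_of_nonneg (fun z hz => ?_) fun z _ _ => hw _
        obtain ⟨e, he, rfl⟩ := Finset.mem_image.1 hz
        exact Finset.mem_filter.2 ⟨Finset.mem_univ _, hadj e he⟩
    _ = ∑ p, (Finset.univ.filter fun q => dist (y p) (y q) ≤ δ).card * w p := by
        rw [Finset.sum_filter, Fintype.sum_prod_type]
        refine Finset.sum_congr rfl fun p _ => ?_
        rw [← Finset.sum_filter]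
        exact (Finset.sum_const (w p)).trans (nsmul_eq_mul _ _)
    _ ≤ ∑ p, (2 * d + 3) ^ d * U * w p :=
        Finset.sum_le_sum fun p _ =>
          mul_le_mul_of_nonneg_right (card_filter_dist_le hR hy hup hU p) (hw p)
    _ = _ := by
        rw [← Finset.mul_sum, Finset.sum_add_distrib, ← Finset.mul_sum Finset.univ _ (2 * C_f),
          Finset.sum_boole]
        simp

end Graph

/-! ### The tail bound at fixed scales -/

open Classical in
/-- Markov's inequality for the number of events that occur; measurability is not needed. -/
lemma measure_le_card_filter_le {Ω V : Type*} [MeasurableSpace Ω] [Fintype V] (P : Measure Ω)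
    (A : V → Set Ω) {q : ENNReal} (hA : ∀ p, P (A p) ≤ q) {t : ℝ} (ht : 0 < t) :
    P {ω | t ≤ (Finset.univ.filter fun p => ω ∈ A p).card} ≤
      Fintype.card V * q / ENNReal.ofReal t := by
  let g : Ω → ENNReal := fun ω => ∑ p, (toMeasurable P (A p)).indicator 1 ω
  have hm (p : V) : Measurable ((toMeasurable P (A p)).indicator (1 : Ω → ENNReal)) :=
    measurable_one.indicator (measurableSet_toMeasurable P (A p))
  have hg : Measurable g := Finset.measurable_fun_sum _ fun p _ => hm p
  have hint : ∫⁻ ω, g ω ∂P ≤ Fintype.card V * q := by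
    rw [lintegral_finsetSum _ fun p _ => hm p]
    refine (Finset.sum_le_card_nsmul _ _ q fun p _ => ?_).trans_eq ?_
    · rw [lintegral_indicator_one (measurableSet_toMeasurable P (A p)), measure_toMeasurable]
      exact hA p
    · rw [nsmul_eq_mul, Finset.card_univ]
  refine (measure_mono fun ω hω => ?_).trans ((meas_ge_le_lintegral_div hg.aemeasurable
    (ENNReal.ofReal_pos.2 ht).ne' ENNReal.ofReal_ne_top).trans (ENNReal.div_le_div_right hint _))
  have h1 : ENNReal.ofReal t ≤ ((Finset.univ.filter fun p => ω ∈ A p).card : ENNReal) := by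
    rw [← ENNReal.ofReal_natCast]
    exact ENNReal.ofReal_le_ofReal hω
  refine h1.trans ?_
  rw [Finset.card_filter]
  push_cast
  refine Finset.sum_le_sum fun p _ => ?_
  split_ifs with hp
  · rw [Set.indicator_of_mem (subset_toMeasurable P (A p) hp)]; rfl
  · exact zero_le

/-- The tail of the total variation for given grid scale `R` and residue modulus `a`. The first
term bounds the probability that some cell has an atypical count, the second one is Markov's
inequality for the number of points in the bad region. -/
lemma DesignAssumption.measure_graphTV_gt_le {Ω : Type*} [MeasurableSpace Ω] {P : Measure Ω}
    [IsProbabilityMeasure P] {d n : ℕ} {m : Fin n → ℕ}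
    {x : (i : Fin n) → Fin (m i) → Ω → Euc d} {v f : Euc d → ℝ} {S : Set (Euc d)}
    {vmin vmax Cβ c C C_f C_S ε₀ L : ℝ}
    (h : DesignAssumption P m x v vmin vmax Cβ c C)
    (hf : IsPiecewiseLipschitzOff f S C_f C_S ε₀ L)
    (hd : 1 ≤ d) (hvmin : 0 < vmin) (hvmax : 0 < vmax) (hw : 0 ≤ c * harmonicMean m)
    (hL : 0 ≤ L) (hCf : 0 ≤ C_f) {R a K : ℕ} (hR : 0 < R) (ha : 0 < a)
    (hε : 2 * (√d / R) < ε₀)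
    (hK : (K : ℝ) + 1 ≤ vmin * (1 / (R : ℝ)) ^ d / 4 * (∑ i, m i : ℕ)) {t : ℝ} (ht : 0 < t) :
    P {ω | (2 * d + 3) ^ d * (3 * (vmax * (1 / (R : ℝ)) ^ d) * (∑ i, m i : ℕ)) *
          ((∑ i, m i : ℕ) * (L * (√d / R)) + 2 * C_f * t) <
        graphTV (knnGraph K (fun p : (i : Fin n) × Fin (m i) => x p.1 p.2 ω))
          (fun p => f (x p.1 p.2 ω))} ≤
      ENNReal.ofReal (R ^ d * (a * (2 * Real.exp (-(vmin * (1 / (R : ℝ)) ^ d *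
        (c * harmonicMean m * (n / (2 * a))) / 4)) + 2 * (n * Real.exp (-Cβ * a))))) +
      ENNReal.ofReal ((∑ i, m i : ℕ) * (vmax * (C_S * (2 * (√d / R)))) / t) := by
  classical
  set δ : ℝ := √d / R
  have hδ : 0 < δ := by
    have : (0 : ℝ) < d := by exact_mod_cast hd
    positivity
  set N : ℕ := ∑ i, m i
  have hN : Fintype.card ((i : Fin n) × Fin (m i)) = N := by simp [N]
  set U : ℝ := 3 * (vmax * (1 / (R : ℝ)) ^ d) * N
  have hU : 0 ≤ U := by positivity
  let cnt : (Fin d → ℕ) → Ω → ℕ := fun u ω =>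
    (Finset.univ.filter fun q : (i : Fin n) × Fin (m i) => x q.1 q.2 ω ∈ gridCell R u).card
  let E1 : (Fin d → ℕ) → Set Ω := fun u =>
    {ω | ¬ (vmin * (1 / (R : ℝ)) ^ d / 4 * N ≤ cnt u ω ∧ (cnt u ω : ℝ) ≤ U)}
  let E2 : (i : Fin n) × Fin (m i) → Set Ω := fun q => {ω | x q.1 q.2 ω ∉ unitCube d}
  let A : (i : Fin n) × Fin (m i) → Set Ω := fun q => {ω | x q.1 q.2 ω ∈ badRegion d S (2 * δ)}
  let E3 : Set Ω := {ω | t ≤ (Finset.univ.filter fun q => ω ∈ A q).card}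
  have hsub : {ω | (2 * d + 3) ^ d * U * (N * (L * δ) + 2 * C_f * t) <
        graphTV (knnGraph K (fun p : (i : Fin n) × Fin (m i) => x p.1 p.2 ω))
          (fun p => f (x p.1 p.2 ω))} ⊆ ((⋃ u ∈ gridIndex d R, E1 u) ∪ ⋃ q, E2 q) ∪ E3 := by
    intro ω hω
    by_contra hcon
    simp only [Set.mem_union, not_or, Set.mem_iUnion, not_exists] at hcon
    obtain ⟨⟨h1, h2⟩, h3⟩ := hcon
    have h1' (u) (hu : u ∈ gridIndex d R) :
        vmin * (1 / (R : ℝ)) ^ d / 4 * N ≤ cnt u ω ∧ (cnt u ω : ℝ) ≤ U := not_not.1 (h1 u hu)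
    have h2' (q : (i : Fin n) × Fin (m i)) : x q.1 q.2 ω ∈ unitCube d := not_not.1 (h2 q)
    have h3' : ((Finset.univ.filter fun q => ω ∈ A q).card : ℝ) < t := not_le.1 h3
    have h4 (u) (hu : u ∈ gridIndex d R) : K + 1 ≤ cnt u ω := by
      have := hK.trans (h1' u hu).1
      exact_mod_cast this
    have h5 (u) (hu : u ∈ gridIndex d R) : (cnt u ω : ℝ) ≤ U := (h1' u hu).2
    simp only [cnt] at h4 h5
    have key := graphTV_knnGraph_le (y := fun p : (i : Fin n) × Fin (m i) => x p.1 p.2 ω)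
      hd hR h2' hf hL hCf hε h4 h5 hU
    rw [hN] at key
    rw [Set.mem_ofPred_eq] at hω
    refine hω.not_ge (key.trans ?_)
    refine mul_le_mul_of_nonneg_left ?_ (by positivity)
    gcongr
    exact h3'.le
  have hE1 : P (⋃ u ∈ gridIndex d R, E1 u) ≤ ENNReal.ofReal (R ^ d * (a * (2 * Real.exp (-(vmin *
      (1 / (R : ℝ)) ^ d * (c * harmonicMean m * (n / (2 * a))) / 4)) +
      2 * (n * Real.exp (-Cβ * a))))) := by
    rw [← ENNReal.ofReal_toReal (measure_ne_top P (⋃ u ∈ gridIndex d R, E1 u))]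
    refine ENNReal.ofReal_le_ofReal ((measureReal_biUnion_finset_le _ _).trans
      ((Finset.sum_le_card_nsmul _ _ _ fun u hu =>
        h.measureReal_cell_deviation_le hvmin hvmax hw ha hu).trans_eq ?_))
    rw [card_gridIndex, nsmul_eq_mul]
    push_cast
    rfl
  have hE2 : P (⋃ q, E2 q) = 0 :=
    measure_iUnion_null fun q => h.measure_mem_compl_unitCube q.1 q.2
  have hA (q : (i : Fin n) × Fin (m i)) : P (A q) ≤ ENNReal.ofReal (vmax * (C_S * (2 * δ))) := by
    refine (h.measure_mem_le q.1 q.2 _).trans ?_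
    rw [ENNReal.ofReal_mul hvmax.le]
    gcongr
    exact hf.volume_le (2 * δ) (by positivity) hε
  have hE3 : P E3 ≤ ENNReal.ofReal (N * (vmax * (C_S * (2 * δ))) / t) := by
    refine (measure_le_card_filter_le P A hA ht).trans_eq ?_
    rw [hN, ENNReal.ofReal_div_of_pos ht, ENNReal.ofReal_mul (Nat.cast_nonneg _),
      ENNReal.ofReal_natCast]
  refine (measure_mono hsub).trans ((measure_union_le _ _).trans (add_le_add ?_ hE3))
  refine (measure_union_le _ _).trans ?_
  rw [hE2, add_zero]
  exact hE1

/-! ### Choice of the scales -/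

/-- The choice of scales: cells of volume of order `K / x` and residue modulus of order `log x`,
where `x` stands for `n m` and `K = ⌈log ^ (2 + l) x⌉`. The extra power `l` of the logarithm makes
`K / a` exceed every multiple of `log x`, which pays for the union bound over the cells. -/
lemma eventually_exists_scales {d : ℕ} (hd : 1 ≤ d) {l κ Cβ ε₀ : ℝ} (hl : 0 < l) (hκ : 0 < κ)
    (hCβ : 0 < Cβ) (hε₀ : 0 < ε₀) :
    ∀ᶠ x : ℝ in atTop, ∃ R a : ℕ, 0 < R ∧ 0 < a ∧ 2 * (√d / R) < ε₀ ∧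
      1 ≤ ⌈Real.log x ^ (2 + l)⌉₊ ∧
      (⌈Real.log x ^ (2 + l)⌉₊ : ℝ) ≤ 2 * Real.log x ^ (2 + l) ∧
      κ * ⌈Real.log x ^ (2 + l)⌉₊ / x ≤ (1 / (R : ℝ)) ^ d ∧
      (1 / (R : ℝ)) ^ d ≤ 2 ^ d * (κ * ⌈Real.log x ^ (2 + l)⌉₊ / x) ∧
      x * (√d / R) ≤ 2 * √d * (2 * κ) ^ (1 / (d : ℝ)) *
        (x ^ (1 - 1 / (d : ℝ)) * Real.log x ^ ((2 + l) / (d : ℝ))) ∧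
      3 * Real.log x ≤ ⌈Real.log x ^ (2 + l)⌉₊ / (a : ℝ) ∧
      4 * Real.log x ≤ Cβ * a ∧
      (R : ℝ) ^ d * a ≤ (4 / Cβ + 1) / κ * x ^ 2 := by
  have hlog := Real.tendsto_log_atTop
  have e1 : ∀ᶠ x : ℝ in atTop, 1 ≤ Real.log x := hlog.eventually_ge_atTop 1
  have e2 : ∀ᶠ x : ℝ in atTop, 3 * (4 / Cβ + 1) ≤ Real.log x ^ l :=
    ((tendsto_rpow_atTop hl).comp hlog).eventually_ge_atTop _
  let B : ℝ := max 2 (4 * √d / ε₀ + 1)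
  have hB : 0 < B := lt_of_lt_of_le two_pos (le_max_left _ _)
  have e3 : ∀ᶠ x : ℝ in atTop, Real.log x ^ (2 + l) ≤ 1 / (2 * κ * B ^ d) * x := by
    have h := (isLittleO_log_rpow_rpow_atTop (2 + l) (one_pos)).bound
      (c := 1 / (2 * κ * B ^ d)) (by positivity)
    filter_upwards [h, e1, eventually_gt_atTop 0] with x hx h1 h0
    rw [Real.rpow_one, Real.norm_of_nonneg (by positivity), Real.norm_of_nonneg h0.le] at hx
    exact hx
  filter_upwards [e1, e2, e3, eventually_ge_atTop 1] with x h1 h2 h3 hx1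
  have hx : 0 < x := by linarith
  set ℓ := Real.log x
  have hℓ : 0 < ℓ := by linarith
  set K : ℕ := ⌈ℓ ^ (2 + l)⌉₊
  have hp1 : 1 ≤ ℓ ^ (2 + l) := Real.one_le_rpow h1 (by linarith)
  have hK1 : ℓ ^ (2 + l) ≤ K := Nat.le_ceil _
  have hK2 : (K : ℝ) ≤ 2 * ℓ ^ (2 + l) := by
    have := (Nat.ceil_lt_add_one (a := ℓ ^ (2 + l)) (by positivity)).le
    linarith
  have hK0 : (1 : ℝ) ≤ K := hp1.trans hK1
  let z : ℝ := x / (κ * K)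
  have hz : 0 < z := by positivity
  let y : ℝ := z ^ (1 / (d : ℝ))
  have hyd : y ^ d = z := by
    simp only [y, one_div]
    exact Real.rpow_inv_natCast_pow hz.le (by omega)
  have hy0 : 0 < y := by positivity
  have hyB : B ≤ y := by
    refine le_of_pow_le_pow_left₀ (n := d) (by omega) hy0.le ?_
    rw [hyd, le_div_iff₀ (by positivity)]
    calc B ^ d * (κ * K) ≤ B ^ d * (κ * (2 * (1 / (2 * κ * B ^ d) * x))) := by
          gcongr
          linarith
      _ = x := by field_simp
  have hy2 : 2 ≤ y := (le_max_left _ _).trans hyB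
  have hyε : 4 * √d / ε₀ < y := by
    have := (le_max_right 2 (4 * √d / ε₀ + 1)).trans hyB
    linarith
  let R : ℕ := ⌊y⌋₊
  have hR1 : (R : ℝ) ≤ y := Nat.floor_le hy0.le
  have hR2 : y / 2 ≤ R := by
    have := Nat.lt_floor_add_one y
    linarith
  have hR0 : (0 : ℝ) < R := by linarith
  let a : ℕ := ⌈4 / Cβ * ℓ⌉₊
  have ha1 : 4 / Cβ * ℓ ≤ a := Nat.le_ceil _
  have ha0 : (0 : ℝ) < a := lt_of_lt_of_le (by positivity) ha1
  have ha2 : (a : ℝ) ≤ (4 / Cβ + 1) * ℓ := by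
    have := (Nat.ceil_lt_add_one (a := 4 / Cβ * ℓ) (by positivity)).le
    linarith
  have hRy : 1 / (R : ℝ) ≤ 2 / y := by
    rw [div_le_div_iff₀ hR0 hy0]; linarith
  have hδy : √d / R ≤ 2 * √d / y := by
    rw [div_le_div_iff₀ hR0 hy0]
    nlinarith [Real.sqrt_nonneg (d : ℝ)]
  have hyz : (1 / y) ^ d = κ * K / x := by
    rw [div_pow, one_pow, hyd, one_div_div]
  refine ⟨R, a, by exact_mod_cast hR0, by exact_mod_cast ha0, ?_, by exact_mod_cast hK0, hK2,
    ?_, ?_, ?_, ?_, ?_, ?_⟩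
  · have h4 : 2 * (2 * √d / y) < ε₀ := by
      rw [div_lt_iff₀ hε₀] at hyε
      rw [mul_div_assoc', div_lt_iff₀ hy0]
      linarith
    linarith
  · rw [← hyz]
    gcongr
  · rw [← hyz, ← mul_pow]
    refine pow_le_pow_left₀ (by positivity) (hRy.trans_eq (by ring)) d
  · have hinv : 1 / y = (κ * K / x) ^ (1 / (d : ℝ)) := by
      simp only [y, z]
      rw [one_div, ← Real.inv_rpow (by positivity), inv_div]
    have hle : 1 / y ≤ (2 * κ) ^ (1 / (d : ℝ)) * ℓ ^ ((2 + l) / (d : ℝ)) /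
        x ^ (1 / (d : ℝ)) := by
      rw [hinv]
      calc (κ * K / x) ^ (1 / (d : ℝ)) ≤ (2 * κ * ℓ ^ (2 + l) / x) ^ (1 / (d : ℝ)) := by
            refine Real.rpow_le_rpow (by positivity) ?_ (by positivity)
            refine div_le_div_of_nonneg_right ?_ hx.le
            nlinarith
        _ = _ := by
            rw [Real.div_rpow (by positivity) hx.le, Real.mul_rpow (by positivity) (by positivity),
              ← Real.rpow_mul hℓ.le, mul_one_div]
    calc x * (√d / R) ≤ x * (2 * √d * (1 / y)) := by
          rw [mul_one_div]; gcongr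
      _ ≤ x * (2 * √d * ((2 * κ) ^ (1 / (d : ℝ)) * ℓ ^ ((2 + l) / (d : ℝ)) /
        x ^ (1 / (d : ℝ)))) := by gcongr
      _ = _ := by
          rw [Real.rpow_sub hx, Real.rpow_one]
          ring
  · rw [le_div_iff₀ ha0]
    calc 3 * ℓ * a ≤ 3 * ℓ * ((4 / Cβ + 1) * ℓ) := by gcongr
      _ = (3 * (4 / Cβ + 1)) * ℓ ^ 2 := by ring
      _ ≤ ℓ ^ l * ℓ ^ 2 := by gcongr
      _ = ℓ ^ (2 + l) := by
          rw [add_comm, Real.rpow_add hℓ, Real.rpow_two]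
      _ ≤ K := hK1
  · rw [div_mul_eq_mul_div, div_le_iff₀ hCβ] at ha1
    linarith
  · have hℓx : ℓ ≤ x := (Real.log_le_sub_one_of_pos hx).trans (by linarith)
    calc (R : ℝ) ^ d * a ≤ y ^ d * ((4 / Cβ + 1) * x) := by
          gcongr
          exact ha2.trans (by gcongr)
      _ = x / (κ * K) * ((4 / Cβ + 1) * x) := by rw [hyd]
      _ ≤ x / (κ * 1) * ((4 / Cβ + 1) * x) := by gcongr
      _ = _ := by field_simp

/-! ### The rate -/

section Rate

variable {Ω : Type*} [MeasurableSpace Ω] {P : Measure Ω} {d n : ℕ}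
  {m : Fin n → ℕ} {x : (i : Fin n) → Fin (m i) → Ω → Euc d} {v : Euc d → ℝ}
  {vmin vmax Cβ c C : ℝ}

lemma DesignAssumption.one_le_harmonicMean (h : DesignAssumption P m x v vmin vmax Cβ c C)
    (hn : 0 < n) : 1 ≤ harmonicMean m := by
  have hn' : (0 : ℝ) < n := by exact_mod_cast hn
  have hm (i : Fin n) : (1 : ℝ) ≤ m i := by exact_mod_cast h.pos i
  have hne : (Finset.univ : Finset (Fin n)).Nonempty := ⟨⟨0, hn⟩, Finset.mem_univ _⟩
  refine (one_le_inv₀ ?_).2 ?_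
  · refine mul_pos (by positivity) (Finset.sum_pos (fun i _ => ?_) hne)
    have := hm i
    positivity
  · have : ∑ i, 1 / (m i : ℝ) ≤ n := by
      refine (Finset.sum_le_card_nsmul _ _ 1 fun i _ => ?_).trans_eq (by simp)
      rw [div_le_one (by linarith [hm i])]
      exact hm i
    rw [one_div, inv_mul_le_iff₀ hn', mul_one]
    exact this

lemma DesignAssumption.sum_bounds (h : DesignAssumption P m x v vmin vmax Cβ c C) :
    c * (n * harmonicMean m) ≤ (∑ i, m i : ℕ) ∧
      ((∑ i, m i : ℕ) : ℝ) ≤ C * (n * harmonicMean m) := by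
  push_cast
  constructor
  · refine le_trans (le_of_eq ?_) (Finset.card_nsmul_le_sum _ _ _ fun i _ => (h.comparable i).1)
    simp; ring
  · refine (Finset.sum_le_card_nsmul _ _ _ fun i _ => (h.comparable i).2).trans_eq ?_
    simp; ring

lemma DesignAssumption.vmin_le_vmax (h : DesignAssumption P m x v vmin vmax Cβ c C) :
    vmin ≤ vmax := by
  have h0 : (0 : Euc d) ∈ unitCube d := fun k => by simp
  exact (h.density_bounds 0 h0).1.trans (h.density_bounds 0 h0).2

/-- Non-asymptotic form of the rate, for scales `R`, `a` as in `eventually_exists_scales` with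
`κ = 8 / (vmin c)`, the value for which a cell contains at least `2 K` points typically. -/
lemma DesignAssumption.measure_graphTV_gt_le_of_scales [IsProbabilityMeasure P]
    {f : Euc d → ℝ} {S : Set (Euc d)} {C_f C_S ε₀ L l κ B X ρ : ℝ}
    (h : DesignAssumption P m x v vmin vmax Cβ c C)
    (hf : IsPiecewiseLipschitzOff f S C_f C_S ε₀ L) (hd : 1 ≤ d) (hn : 0 < n)
    (hvmin : 0 < vmin) (hc : 0 < c) (hC : 0 < C) (hCf : 0 < C_f)
    (hCS : 0 < C_S) (hL : 0 < L) (hκ : κ * (vmin * c) = 8) (hX : X = n * harmonicMean m)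
    (hX1 : 1 < X) (hρ : 0 < ρ) {R a K : ℕ} (hR : 0 < R) (ha : 0 < a) (hε : 2 * (√d / R) < ε₀)
    (hK1 : 1 ≤ K) (hK2 : (K : ℝ) ≤ 2 * Real.log X ^ (2 + l))
    (hcell1 : κ * K / X ≤ (1 / (R : ℝ)) ^ d) (hcell2 : (1 / (R : ℝ)) ^ d ≤ 2 ^ d * (κ * K / X))
    (hδ : X * (√d / R) ≤ B * ρ) (hKa : 3 * Real.log X ≤ K / (a : ℝ))
    (hβ : 4 * Real.log X ≤ Cβ * a) (hRa : (R : ℝ) ^ d * a ≤ (4 / Cβ + 1) / κ * X ^ 2)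
    {s : ℝ} (hs : 0 < s) :
    P {ω | (2 * d + 3) ^ d * (6 * vmax * 2 ^ d * κ * C) * (C * L * B + 2 * C_f * s) *
          (ρ * Real.log X ^ (2 + l)) <
        graphTV (knnGraph K (fun p : (i : Fin n) × Fin (m i) => x p.1 p.2 ω))
          (fun p => f (x p.1 p.2 ω))} ≤
      ENNReal.ofReal (4 * ((4 / Cβ + 1) / κ) / X) +
        ENNReal.ofReal (2 * C * vmax * C_S * B / s) := by
  have hvmax : 0 < vmax := hvmin.trans_le h.vmin_le_vmax
  have hX0 : 0 < X := by linarith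
  have hh := h.one_le_harmonicMean hn
  obtain ⟨hN1, hN2⟩ := h.sum_bounds
  rw [← hX] at hN1 hN2
  have hn' : (0 : ℝ) < n := by exact_mod_cast hn
  have ha' : (0 : ℝ) < a := by exact_mod_cast ha
  have hR' : (0 : ℝ) < R := by exact_mod_cast hR
  have hK' : (1 : ℝ) ≤ K := by exact_mod_cast hK1
  have hκ0 : 0 < κ := (pos_iff_pos_of_mul_pos (by rw [hκ]; norm_num)).2
    (by positivity : 0 < vmin * c)
  have hlog : 0 < Real.log X := Real.log_pos hX1
  have hnX : (n : ℝ) ≤ X := by rw [hX]; exact le_mul_of_one_le_right hn'.le hh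
  have hcount : (K : ℝ) + 1 ≤ vmin * (1 / (R : ℝ)) ^ d / 4 * (∑ i, m i : ℕ) := by
    calc (K : ℝ) + 1 ≤ κ * (vmin * c) / 4 * K := by rw [hκ]; linarith
      _ = vmin * (κ * K / X) / 4 * (c * X) := by field_simp
      _ ≤ _ := by gcongr
  have hmain := h.measure_graphTV_gt_le hf hd hvmin hvmax (by positivity) hL.le hCf.le hR ha hε
    hcount (t := s * ρ) (by positivity)
  refine (measure_mono fun ω hω => ?_).trans (hmain.trans (add_le_add ?_ ?_))
  · rw [Set.mem_ofPred_eq] at hω ⊢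
    refine lt_of_le_of_lt ?_ hω
    have hU : 3 * (vmax * (1 / (R : ℝ)) ^ d) * (∑ i, m i : ℕ) ≤
        6 * vmax * 2 ^ d * κ * C * Real.log X ^ (2 + l) := by
      calc 3 * (vmax * (1 / (R : ℝ)) ^ d) * (∑ i, m i : ℕ)
          ≤ 3 * (vmax * (2 ^ d * (κ * (2 * Real.log X ^ (2 + l)) / X))) * (C * X) := by
            gcongr
            refine hcell2.trans ?_
            gcongr
        _ = _ := by field_simp; ring
    have hT : ((∑ i, m i : ℕ) : ℝ) * (L * (√d / R)) + 2 * C_f * (s * ρ) ≤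
        (C * L * B + 2 * C_f * s) * ρ := by
      calc ((∑ i, m i : ℕ) : ℝ) * (L * (√d / R)) + 2 * C_f * (s * ρ)
          ≤ C * X * (L * (√d / R)) + 2 * C_f * (s * ρ) := by gcongr
        _ = C * L * (X * (√d / R)) + 2 * C_f * (s * ρ) := by ring
        _ ≤ C * L * (B * ρ) + 2 * C_f * (s * ρ) := by gcongr
        _ = _ := by ring
    calc _ ≤ (2 * (d : ℝ) + 3) ^ d * (6 * vmax * 2 ^ d * κ * C * Real.log X ^ (2 + l)) *
          ((C * L * B + 2 * C_f * s) * ρ) := by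
          refine mul_le_mul ?_ hT (by positivity) (by positivity)
          gcongr
      _ = _ := by ring
  · refine ENNReal.ofReal_le_ofReal ?_
    have hpow (k : ℕ) : Real.exp (-(k * Real.log X)) = (X ^ k)⁻¹ := by
      rw [Real.exp_neg, ← Real.log_pow, Real.exp_log (by positivity)]
    have hE1 : Real.exp (-(vmin * (1 / (R : ℝ)) ^ d * (c * harmonicMean m * (n / (2 * a))) / 4)) ≤
        (X ^ 3)⁻¹ := by
      rw [← hpow 3]
      refine Real.exp_le_exp.2 (neg_le_neg ?_)
      push_cast
      calc 3 * Real.log X ≤ K / (a : ℝ) := hKa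
        _ = κ * (vmin * c) / 8 * (K / a) := by rw [hκ]; ring
        _ = vmin * (κ * K / X) * (c * X / (2 * a)) / 4 := by field_simp; ring
        _ ≤ vmin * (1 / (R : ℝ)) ^ d * (c * X / (2 * a)) / 4 := by gcongr
        _ = _ := by rw [hX]; ring
    have hE2 : n * Real.exp (-Cβ * a) ≤ (X ^ 3)⁻¹ := by
      calc n * Real.exp (-Cβ * a) ≤ X * Real.exp (-((4 : ℕ) * Real.log X)) := by
            gcongr
            push_cast
            linarith
        _ = (X ^ 3)⁻¹ := by rw [hpow 4]; field_simp
    calc _ = (R : ℝ) ^ d * a * (2 * Real.exp (-(vmin * (1 / (R : ℝ)) ^ d *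
          (c * harmonicMean m * (n / (2 * a))) / 4)) + 2 * (n * Real.exp (-Cβ * a))) := by ring
      _ ≤ (4 / Cβ + 1) / κ * X ^ 2 * (2 * (X ^ 3)⁻¹ + 2 * (X ^ 3)⁻¹) := by
          refine mul_le_mul hRa (by linarith) (by positivity) (le_trans (by positivity) hRa)
      _ = _ := by field_simp; ring
  · refine ENNReal.ofReal_le_ofReal ?_
    calc _ ≤ C * X * (vmax * (C_S * (2 * (√d / R)))) / (s * ρ) := by gcongr
      _ = 2 * C * vmax * C_S * (X * (√d / R)) / (s * ρ) := by ring
      _ ≤ 2 * C * vmax * C_S * (B * ρ) / (s * ρ) := by gcongr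
      _ = _ := by field_simp

end Rate

lemma graphTV_nonneg {V : Type*} [Fintype V] (G : SimpleGraph V) (θ : V → ℝ) :
    0 ≤ graphTV G θ := by
  refine Finset.sum_nonneg fun e _ => ?_
  induction e with
  | _ p q => exact abs_nonneg _

theorem mainTheorem7 {d : ℕ} (hd : 1 ≤ d)
    {Ω : ℕ → Type*} [∀ n, MeasurableSpace (Ω n)]
    (P : (n : ℕ) → Measure (Ω n)) [∀ n, IsProbabilityMeasure (P n)]
    (m : (n : ℕ) → Fin n → ℕ)
    (x : (n : ℕ) → (i : Fin n) → Fin (m n i) → Ω n → Euc d)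
    (v : ℕ → Euc d → ℝ) (f : ℕ → Euc d → ℝ) (S : ℕ → Set (Euc d))
    (vmin vmax Cβ c C C_f C_S ε₀ L l : ℝ)
    (hvmin : 0 < vmin) (hCβ : 0 < Cβ) (hc : 0 < c) (hC : 0 < C)
    (hC_f : 0 < C_f) (hC_S : 0 < C_S) (hε₀ : 0 < ε₀) (hL : 0 < L) (hl : 0 < l)
    (hx : ∀ n, DesignAssumption (P n) (m n) (x n) (v n) vmin vmax Cβ c C)
    (hf : ∀ n, IsPiecewiseLipschitzOff (f n) (S n) C_f C_S ε₀ L) :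
    IsBigOInProb P
      (fun n ω =>
        graphTV
          (knnGraph ⌈Real.log (n * harmonicMean (m n)) ^ (2 + l)⌉₊
            (fun p : (i : Fin n) × Fin (m n i) => x n p.1 p.2 ω))
          (fun p => f n (x n p.1 p.2 ω)))
      (fun n =>
        ((n : ℝ) * harmonicMean (m n)) ^ (1 - 1 / (d : ℝ)) *
          Real.log (n * harmonicMean (m n)) ^ (2 + l + (2 + l) / (d : ℝ))) := by
  let X : ℕ → ℝ := fun n => n * harmonicMean (m n)
  let ρ : ℕ → ℝ := fun n => X n ^ (1 - 1 / (d : ℝ)) * Real.log (X n) ^ ((2 + l) / (d : ℝ))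
  have hX : Tendsto X atTop atTop := by
    refine tendsto_atTop_mono' _ ?_ tendsto_natCast_atTop_atTop
    filter_upwards [eventually_gt_atTop 0] with n hn
    exact le_mul_of_one_le_right (Nat.cast_nonneg n) ((hx n).one_le_harmonicMean hn)
  have hvmax : 0 < vmax := hvmin.trans_le (hx 0).vmin_le_vmax
  have hd0 : (0 : ℝ) < d := by exact_mod_cast hd
  let κ : ℝ := 8 / (vmin * c)
  have hκ0 : 0 < κ := by positivity
  have hκ : κ * (vmin * c) = 8 := div_mul_cancel₀ _ (by positivity)
  let B : ℝ := 2 * √d * (2 * κ) ^ (1 / (d : ℝ))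
  let D : ℝ := (2 * d + 3) ^ d * (6 * vmax * 2 ^ d * κ * C)
  have hD : 0 < D := by positivity
  have hB : 0 < B := by positivity
  let A₀ : ℝ := D * (C * L * B)
  let A₁ : ℝ := D * (2 * C_f)
  let A₂ : ℝ := 2 * C * vmax * C_S * B
  have hA₁ : 0 < A₁ := by positivity
  have hbound : ∀ᶠ M : ℝ in atTop, limsup (fun n => P n {ω | M * (X n ^ (1 - 1 / (d : ℝ)) *
        Real.log (X n) ^ (2 + l + (2 + l) / (d : ℝ))) ≤
      |graphTV (knnGraph ⌈Real.log (X n) ^ (2 + l)⌉₊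
          (fun p : (i : Fin n) × Fin (m n i) => x n p.1 p.2 ω))
        (fun p => f n (x n p.1 p.2 ω))|}) atTop ≤
      ENNReal.ofReal (A₂ / ((M - A₀) / (2 * A₁))) := by
    filter_upwards [eventually_gt_atTop A₀] with M hM
    -- this `s` gives `A₀ + A₁ s = (M + A₀) / 2 < M`
    let s : ℝ := (M - A₀) / (2 * A₁)
    have hs : 0 < s := div_pos (by linarith) (by positivity)
    have hsM : D * (C * L * B + 2 * C_f * s) < M := by
      have h1 : A₁ * s = (M - A₀) / 2 := by simp only [s]; field_simp
      have h2 : D * (C * L * B + 2 * C_f * s) = A₀ + A₁ * s := by simp only [A₀, A₁]; ring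
      rw [h2, h1]; linarith
    have htail : Tendsto (fun n => ENNReal.ofReal (4 * ((4 / Cβ + 1) / κ) / X n) +
        ENNReal.ofReal (A₂ / s)) atTop (𝓝 (ENNReal.ofReal (A₂ / s))) := by
      have h0 := ENNReal.tendsto_ofReal (hX.const_div_atTop (4 * ((4 / Cβ + 1) / κ)))
      simpa using h0.add_const (ENNReal.ofReal (A₂ / s))
    refine le_trans (limsup_le_limsup ?_) htail.limsup_eq.le
    filter_upwards [hX.eventually (eventually_exists_scales hd hl hκ0 hCβ hε₀),
      hX.eventually_gt_atTop 1, eventually_gt_atTop 0] with n hn hX1 hn0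
    obtain ⟨R, a, hR, ha, hε, hK1, hK2, hcell1, hcell2, hδ, hKa, hβ, hRa⟩ := hn
    have hlog : 0 < Real.log (X n) := Real.log_pos hX1
    have hρ : 0 < ρ n := by
      have : 0 < X n := by linarith
      positivity
    refine (measure_mono fun ω hω => ?_).trans
      ((hx n).measure_graphTV_gt_le_of_scales (hf n) hd hn0 hvmin hc hC hC_f hC_S hL hκ rfl hX1 hρ
        hR ha hε hK1 hK2 hcell1 hcell2 hδ hKa hβ hRa hs)
    rw [Set.mem_ofPred_eq] at hω ⊢
    rw [abs_of_nonneg (graphTV_nonneg _ _)] at hω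
    refine lt_of_lt_of_le ?_ hω
    have hrate : X n ^ (1 - 1 / (d : ℝ)) * Real.log (X n) ^ (2 + l + (2 + l) / (d : ℝ)) =
        ρ n * Real.log (X n) ^ (2 + l) := by
      rw [Real.rpow_add hlog]; simp only [ρ]; ring
    rw [hrate]
    exact mul_lt_mul_of_pos_right hsM (by positivity)
  refine tendsto_of_tendsto_of_tendsto_of_le_of_le' tendsto_const_nhds ?_
    (Eventually.of_forall fun _ => zero_le) hbound
  have h1 : Tendsto (fun M : ℝ => (M - A₀) / (2 * A₁)) atTop atTop :=
    (tendsto_atTop_add_const_right _ (-A₀) tendsto_id).atTop_div_const (by positivity)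
  simpa using ENNReal.tendsto_ofReal (h1.const_div_atTop A₂)
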